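/- Let $k$ be an algebraically closed field of characteristic zero. In $SL_3=SL_3(k)$ let $U$ be the group of upper triangular matrices with unit diagonal, $T$ the group of diagonal matrices, $U_\theta=\{1+sE_{13}\mid s\in k\}$ the root subgroup of the highest root $\theta$, and let $\varepsilon_i$ be the $i$-th coordinate character of $T$. Let $k[SL_3/U]$ be the algebra of regular functions $f$ on $SL_3$ with $f(gu)=f(g)$ for all $u\in U$, on which $SL_3$ acts by $(s\cdot f)(g)=f(s^{-1}g)$. For $a,b\in\mathbb N=\{0,1,2,\dots\}$ let $\mathsf R(a,b)$ be the simple rational $SL_3$-module with highest weight $a\varpi_1+b\varpi_2=(a+b)\varepsilon_1+b\varepsilon_2$. Let $\mathfrak a\subset\mathfrak{sl}_3$ be the three-dimensional simple subalgebra spanned by $e=e_\theta=E_{13}$, $h/2=\mathrm{diag}(1,0,-1)$ and $E_{31}$ (here $h=\mathrm{diag}(2,0,-2)$ is the characteristic of the regular nilpotent element $E_{12}+E_{23}$), and let $\mathsf R_n$ be the simple $\mathfrak a$-module of dimension $n+1$. (i) $k[SL_3/U]^{U_\theta}$ is a polynomial algebra of Krull dimension $4$: it is freely generated by the functions $$x_1(g)=(g^{-1})_{31},\quad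 x_2(g)=(g^{-1})_{32},\quad \xi_2(g)=g_{21},\quad \xi_3(g)=g_{31}.$$ (ii) For all $a,b\in\mathbb N$, the space $\mathsf R(a,b)^{U_\theta}$ has dimension $(a+1)(b+1)$ and is a cyclic $U/U_\theta$-module, that is, it is the linear span of the $U/U_\theta$-orbit of some vector (a cyclic vector). Moreover, there is a cyclic vector that is a $T$-eigenvector, and it is unique up to a scalar multiple. (iii) Let $a,b\in\mathbb N$, $p=\max(a,b)$ and $q=\min(a,b)$. As a module over $\mathfrak a$, which acts through the differential of the representation of $SL_3$, $$\mathsf R(a,b)|_{\mathfrak a}\cong\bigoplus_{n=0}^{p+q} m_n\,\mathsf R_n,\qquad m_n=\begin{cases} n+1,& 0\le n\le q,\\ q+1,& q\le n\le p,\\ p+q+1-n,& p\le n\le p+q,\end{cases}$$ that is, for $a\ge b$, $\mathsf R(a,b)|_{\mathfrak a}=\mathsf R_0\oplus2\mathsf R_1\oplus\dots\oplus(b+1)\mathsf R_b\oplus\dots\oplus(b+1)\mathsf R_a\oplus b\,\mathsf R_{a+1}\oplus\dots\oplus\mathsf R_{a+b}$. The $T$-eigen cyclic vector from (ii) spans the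 unique one-dimensional $\mathfrak a$-submodule $\mathsf R_0\subset\mathsf R(a,b)$. -/

import Mathlib

open scoped Matrix

attribute [local instance] LieRing.ofAssociativeRing

namespace SLThree

/-- The group `SL₃(K)`; rows and columns are numbered `0, 1, 2`. -/
abbrev SL3 (K : Type*) [Field K] : Type _ := Matrix.SpecialLinearGroup (Fin 3) K

section Groups

variable (K : Type*) [Field K]

/-- The maximal unipotent subgroup `U`: upper triangular matrices with unit diagonal. -/
def U : Subgroup (SL3 K) where
  carrier := {g | (∀ i, g i i = 1) ∧ ∀ i j, j < i → g i j = 0}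
  one_mem' := by
    refine ⟨fun i => by simp, fun i j hij => ?_⟩
    simp [hij.ne']
  mul_mem' := by
    rintro g g' ⟨h1, h2⟩ ⟨h1', h2'⟩
    have a := h2 1 0 (by decide)
    have b := h2 2 0 (by decide)
    have c := h2 2 1 (by decide)
    have a' := h2' 1 0 (by decide)
    have b' := h2' 2 0 (by decide)
    have c' := h2' 2 1 (by decide)
    constructor
    · intro i
      fin_cases i <;> simp [Matrix.mul_apply, Fin.sum_univ_three, *]
    · intro i j hij
      fin_cases i <;> fin_cases j <;> first
        | exact absurd hij (by decide)
        | simp [Matrix.mul_apply, Fin.sum_univ_three, *]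
  inv_mem' := by
    rintro g ⟨h1, h2⟩
    have a := h2 1 0 (by decide)
    have b := h2 2 0 (by decide)
    have c := h2 2 1 (by decide)
    constructor
    · intro i
      fin_cases i <;>
        simp [Matrix.SpecialLinearGroup.coe_inv, Matrix.adjugate_fin_three, *]
    · intro i j hij
      fin_cases i <;> fin_cases j <;> first
        | exact absurd hij (by decide)
        | simp [Matrix.SpecialLinearGroup.coe_inv, Matrix.adjugate_fin_three, *]

/-- The root subgroup `U_θ` of the highest root `θ = ε₁ - ε₃`: the matrices `1 + s E₁₃`. -/
def Uθ : Subgroup (SL3 K) where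
  carrier := {g | ∃ s : K, (g : Matrix (Fin 3) (Fin 3) K) = Matrix.transvection 0 2 s}
  one_mem' := ⟨0, by simp⟩
  mul_mem' := by
    rintro g g' ⟨s, hs⟩ ⟨s', hs'⟩
    exact ⟨s + s', by
      rw [Matrix.SpecialLinearGroup.coe_mul, hs, hs',
        Matrix.transvection_mul_transvection_same _ _ (by decide)]⟩
  inv_mem' := by
    rintro g ⟨s, hs⟩
    refine ⟨-s, ?_⟩
    rw [Matrix.SpecialLinearGroup.coe_inv, hs]
    ext i j
    fin_cases i <;> fin_cases j <;>
      simp [Matrix.adjugate_fin_three, Matrix.transvection]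

theorem Uθ_le_U : Uθ K ≤ U K := by
  rintro g ⟨s, hs⟩
  refine ⟨fun i => ?_, fun i j hij => ?_⟩
  · rw [hs]
    fin_cases i <;> simp [Matrix.transvection]
  · rw [hs]
    fin_cases i <;> fin_cases j <;> first
      | exact absurd hij (by decide)
      | simp [Matrix.transvection]

/-- The maximal torus `T` of diagonal matrices. -/
def T : Subgroup (SL3 K) where
  carrier := {g | ∀ i j, i ≠ j → g i j = 0}
  one_mem' := fun i j hij => by simp [hij]
  mul_mem' := by
    intro g g' h h' i j hij
    rw [Matrix.SpecialLinearGroup.coe_mul, Matrix.mul_apply]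
    refine Finset.sum_eq_zero fun k _ => ?_
    by_cases hik : i = k
    · subst hik
      rw [h' i j hij, mul_zero]
    · rw [h i k hik, zero_mul]
  inv_mem' := by
    intro g h i j hij
    have e1 := h 0 1 (by decide)
    have e2 := h 0 2 (by decide)
    have e3 := h 1 0 (by decide)
    have e4 := h 1 2 (by decide)
    have e5 := h 2 0 (by decide)
    have e6 := h 2 1 (by decide)
    fin_cases i <;> fin_cases j <;> first
      | exact absurd rfl hij
      | simp [Matrix.SpecialLinearGroup.coe_inv, Matrix.adjugate_fin_three, *]

/-- `U_θ`, viewed as a subgroup of `U`. -/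
abbrev UθInU : Subgroup (U K) := (Uθ K).subgroupOf (U K)

instance UθInU_normal : (UθInU K).Normal where
  conj_mem := by
    rintro ⟨n, hn⟩ ⟨s, hs⟩ ⟨g, hg1, hg2⟩
    refine ⟨s, ?_⟩
    change (n : Matrix (Fin 3) (Fin 3) K) = Matrix.transvection 0 2 s at hs
    change ((g * n * g⁻¹ : SL3 K) : Matrix (Fin 3) (Fin 3) K) = Matrix.transvection 0 2 s
    have a := hg2 1 0 (by decide)
    have b := hg2 2 0 (by decide)
    have c := hg2 2 1 (by decide)
    have key : (g : Matrix (Fin 3) (Fin 3) K) * Matrix.transvection 0 2 s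
        = Matrix.transvection 0 2 s * (g : Matrix (Fin 3) (Fin 3) K) := by
      ext i j
      fin_cases i <;> fin_cases j <;>
        simp [Matrix.transvection, Matrix.mul_apply, Matrix.single_apply, Matrix.one_apply,
          Fin.sum_univ_three, add_comm, *]
    rw [Matrix.SpecialLinearGroup.coe_mul, Matrix.SpecialLinearGroup.coe_mul, hs, key,
      Matrix.mul_assoc, ← Matrix.SpecialLinearGroup.coe_mul, mul_inv_cancel,
      Matrix.SpecialLinearGroup.coe_one, Matrix.mul_one]

end Groups

section Functions

variable (K : Type*) [Field K]

/-- Restriction of a polynomial in the nine matrix entries to `SL₃(K)`. -/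
noncomputable def restrict : MvPolynomial (Fin 3 × Fin 3) K →ₐ[K] (SL3 K → K) :=
  MvPolynomial.aeval fun ij g => g ij.1 ij.2

/-- The algebra `K[SL₃]` of regular functions on `SL₃`. -/
noncomputable def regSL3 : Subalgebra K (SL3 K → K) := (restrict K).range

/-- The algebra `K[SL₃/U]`: regular functions on `SL₃` that are constant on the cosets `gU`. -/
noncomputable def regSL3modU : Subalgebra K (SL3 K → K) where
  carrier := {f | f ∈ regSL3 K ∧ ∀ g : SL3 K, ∀ u ∈ U K, f (g * u) = f g}
  mul_mem' := fun ⟨h1, h2⟩ ⟨h1', h2'⟩ =>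
    ⟨mul_mem h1 h1', fun g u hu => by simp [h2 g u hu, h2' g u hu]⟩
  add_mem' := fun ⟨h1, h2⟩ ⟨h1', h2'⟩ =>
    ⟨add_mem h1 h1', fun g u hu => by simp [h2 g u hu, h2' g u hu]⟩
  algebraMap_mem' := fun r => ⟨(regSL3 K).algebraMap_mem r, fun _ _ _ => rfl⟩

/-- The algebra `K[SL₃/U]^{U_θ}` of invariants for the left action `(u · f)(g) = f(u⁻¹ g)`. -/
noncomputable def invAlgebra : Subalgebra K (SL3 K → K) where
  carrier := {f | f ∈ regSL3modU K ∧ ∀ u ∈ Uθ K, ∀ g : SL3 K, f (u⁻¹ * g) = f g}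
  mul_mem' := fun ⟨h1, h2⟩ ⟨h1', h2'⟩ =>
    ⟨mul_mem h1 h1', fun u hu g => by simp [h2 u hu g, h2' u hu g]⟩
  add_mem' := fun ⟨h1, h2⟩ ⟨h1', h2'⟩ =>
    ⟨add_mem h1 h1', fun u hu g => by simp [h2 u hu g, h2' u hu g]⟩
  algebraMap_mem' := fun r => ⟨(regSL3modU K).algebraMap_mem r, fun _ _ _ => rfl⟩

/-- The four generators `x₁, x₂, ξ₂, ξ₃`. Here `x_j(g) = (g⁻¹)_{3j}`, of weight `ε_j` under the
left action of `T`, and `ξ_i(g) = g_{i1}`, of weight `-ε_i`; all six functions `x_j`, `ξ_i` are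
regular on `SL₃/U`. -/
def generators : Fin 4 → (SL3 K → K) :=
  ![fun g => g⁻¹ 2 0, fun g => g⁻¹ 2 1, fun g => g 1 0, fun g => g 2 0]

end Functions

section Modules

variable {K : Type*} [Field K] {V : Type*} [AddCommGroup V] [Module K V]

/-- `V` is (a model of) the simple `SL₃`-module `R(a,b)`: a finite-dimensional rational irreducible
representation with a highest weight vector, that is a nonzero `U`-fixed vector, of weight
`a ϖ₁ + b ϖ₂ = (a + b) ε₁ + b ε₂`. -/
structure IsSimpleOfHighestWeight (ρ : Representation K (SL3 K) V) (a b : ℕ) : Prop where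
  finite : FiniteDimensional K V
  rational : ∀ (φ : Module.Dual K V) (v : V), (fun g => φ (ρ g v)) ∈ regSL3 K
  irreducible : ρ.IsIrreducible
  highest : ∃ v : V, v ≠ 0 ∧ (∀ u ∈ U K, ρ u v = v) ∧
    ∀ t ∈ T K, ρ t v = (t 0 0 ^ (a + b) * t 1 1 ^ b) • v

/-- The space `V^{U_θ}` (see `mem_invSpace_iff`). -/
noncomputable abbrev InvSpace (ρ : Representation K (SL3 K) V) : Submodule K V :=
  Representation.invariants ((ρ.comp (U K).subtype).comp (UθInU K).subtype)

theorem mem_invSpace_iff (ρ : Representation K (SL3 K) V) (v : V) :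
    v ∈ InvSpace ρ ↔ ∀ u ∈ Uθ K, ρ u v = v := by
  constructor
  · intro h u hu
    exact h ⟨⟨u, Uθ_le_U K hu⟩, hu⟩
  · intro h u
    exact h u.1.1 u.2

/-- `V^{U_θ}` as a representation of the quotient group `U/U_θ`. -/
noncomputable abbrev invRep (ρ : Representation K (SL3 K) V) :
    Representation K (U K ⧸ UθInU K) (InvSpace ρ) :=
  Representation.quotientToInvariants (ρ.comp (U K).subtype) (UθInU K)

/-- A vector is cyclic if the linear span of its orbit is the whole representation. -/
def IsCyclicVector {G : Type*} [Monoid G] {W : Type*} [AddCommGroup W] [Module K W]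
    (σ : Representation K G W) (w : W) : Prop :=
  Submodule.span K (Set.range fun g => σ g w) = ⊤

/-- `v` is an eigenvector of the torus `T`. -/
def IsTEigenvector (ρ : Representation K (SL3 K) V) (v : V) : Prop :=
  v ≠ 0 ∧ ∀ t ∈ T K, ∃ c : K, ρ t v = c • v

end Modules

section LieAlgebra

variable {K : Type*} [Field K]

/-- The Lie algebra `sl₃(K)` of traceless matrices. -/
abbrev sl3 (K : Type*) [Field K] : LieSubalgebra K (Matrix (Fin 3) (Fin 3) K) :=
  LieAlgebra.SpecialLinear.sl (Fin 3) K

/-- The highest root vector `e = e_θ = E₁₃`. -/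
def eθ (K : Type*) [Field K] : sl3 K :=
  LieAlgebra.SpecialLinear.single 0 2 (by decide) 1

/-- The opposite root vector `E₃₁`. -/
def fθ (K : Type*) [Field K] : sl3 K :=
  LieAlgebra.SpecialLinear.single 2 0 (by decide) 1

/-- The element `h/2 = diag(1, 0, -1)`, where `h = diag(2, 0, -2)` is the characteristic of the
regular nilpotent element `e₁ + e₂ = E₁₂ + E₂₃`. -/
def halfH (K : Type*) [Field K] : sl3 K :=
  LieAlgebra.SpecialLinear.singleSubSingle 0 2 1

/-- The subalgebra `𝔞 ≅ sl₂` spanned by the `sl₂`-triple `e, h/2, E₃₁`. -/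
def aLie (K : Type*) [Field K] : LieSubalgebra K (sl3 K) :=
  LieSubalgebra.lieSpan K (sl3 K) {eθ K, halfH K, fθ K}

variable {V : Type*} [AddCommGroup V] [Module K V]

/-- `D` is the differential at `1` of the rational representation `ρ`: for every matrix coefficient
`g ↦ φ (ρ g v)`, written as a polynomial `p` in the matrix entries, `φ (D X v)` is the derivative
of `p` at the identity matrix in the direction `X`. -/
def IsDifferential (ρ : Representation K (SL3 K) V) (D : sl3 K →ₗ⁅K⁆ Module.End K V) : Prop :=
  ∀ (φ : Module.Dual K V) (v : V) (p : MvPolynomial (Fin 3 × Fin 3) K),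
    restrict K p = (fun g => φ (ρ g v)) →
    ∀ X : sl3 K, φ (D X v) = ∑ ij : Fin 3 × Fin 3, X.1 ij.1 ij.2 *
      MvPolynomial.eval (fun kl => (1 : Matrix (Fin 3) (Fin 3) K) kl.1 kl.2)
        (MvPolynomial.pderiv ij p)

/-- The differential of a rational representation is unique. -/
theorem IsDifferential.unique {ρ : Representation K (SL3 K) V}
    (hρ : ∀ (φ : Module.Dual K V) (v : V), (fun g => φ (ρ g v)) ∈ regSL3 K)
    {D D' : sl3 K →ₗ⁅K⁆ Module.End K V} (h : IsDifferential ρ D) (h' : IsDifferential ρ D') :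
    D = D' := by
  ext X v
  refine (Module.forall_dual_apply_eq_zero_iff K _).1 (fun φ => ?_) |> sub_eq_zero.1
  obtain ⟨p, hp⟩ := hρ φ v
  rw [map_sub, h φ v p hp X, h' φ v p hp X, sub_self]

/-- `S` is an `𝔞`-submodule of `V`, where `sl₃` acts through `D`. -/
def IsASubmodule (D : sl3 K →ₗ⁅K⁆ Module.End K V) (S : Submodule K V) : Prop :=
  ∀ X ∈ aLie K, ∀ v ∈ S, D X v ∈ S

/-- `S` is a simple `𝔞`-submodule of dimension `n + 1`, that is a copy of `R_n`. -/
def IsCopyOfR (D : sl3 K →ₗ⁅K⁆ Module.End K V) (n : ℕ) (S : Submodule K V) : Prop :=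
  IsASubmodule D S ∧ Module.finrank K S = n + 1 ∧
    ∀ S' : Submodule K V, S' ≤ S → IsASubmodule D S' → S' = ⊥ ∨ S' = S

/-- For `p ≥ q`, the coefficient of `R_n`, `0 ≤ n ≤ p + q`, in
`R₀ ⊕ 2R₁ ⊕ ⋯ ⊕ (q+1)R_q ⊕ ⋯ ⊕ (q+1)R_p ⊕ qR_{p+1} ⊕ ⋯ ⊕ R_{p+q}`. -/
def branchMult (p q n : ℕ) : ℕ :=
  if n ≤ q then n + 1 else if n ≤ p then q + 1 else p + q + 1 - n

end LieAlgebra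

end SLThree

/-! Write `x_j(g) = (g⁻¹)_{3j}` and `ξ_i(g) = g_{i1}`. A right `U`-invariant function depends only
on these six functions, which satisfy `x₁ξ₁ + x₂ξ₂ + x₃ξ₃ = 0`. Where `ξ₃ ≠ 0`, translation by `U_θ`
moves `ξ₁` freely and the relation then gives `x₃`, so an invariant depends only on `x₁, x₂, ξ₂,
ξ₃`. The section `cellSection` makes it a polynomial divided by a power of `x₁ξ₃`. Since `(x₁, x₂,
ξ₂, ξ₃)` takes generic values on each of `x₁ = 0` and `ξ₃ = 0`, and neither function is a zero
divisor, the denominator cancels (`exists_aeval_generators_eq`).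

A `U`-fixed functional `ψ` embeds `V = R(a,b)` into `K[SL₃/U]` by `w ↦ (g ↦ ψ(g⁻¹w))`. The right
torus weight makes the image of `V^{U_θ}` lie in the span of the monomials `x₁^i x₂^(a-i) ξ₂^(b-l)
ξ₃^l`. All of them occur: they are obtained from the highest weight vector `x₁^a ξ₃^b` with lowering
operators (`exists_eq_monomialFun`). This gives the dimension `(a+1)(b+1)`.

On these monomials `E₁₂` acts as `x₁∂/∂x₂` and `E₂₃` as `-ξ₃∂/∂ξ₂`, so `x₂^a ξ₂^b` is cyclic. Its
coefficient is unchanged by `U`, hence nonzero in every cyclic vector, and a single torus element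
separates its weight from those of the other monomials; this gives uniqueness.

Finally `V^{U_θ} = ker e`, and `h/2` has eigenvalue `i + l` on the monomial with indices `(i, l)`.
By `sl₂`-theory each monomial generates a copy of `R_{i+l}` and `V` is their direct sum, so `m_n`
counts the pairs with `i + l = n`. The only pair with `i + l = 0` is the cyclic vector.

The differential is handled algebraically: `sl₃` is spanned by matrices with `N² = 0`, for which `1
+ tN` is a one-parameter subgroup along which regular functions are polynomials in `t`. -/

namespace SLThree

/-! ### Regular functions on `SL₃`, lines `1 + tN`, and the big cell. -/

section RegularFunctions

variable {K : Type*} [Field K]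

theorem entry_mem_regSL3 (i j : Fin 3) : (fun g : SL3 K => g i j) ∈ regSL3 K :=
  ⟨MvPolynomial.X (i, j), by simp [restrict]⟩

theorem inv_entry_mem_regSL3 (i j : Fin 3) : (fun g : SL3 K => g⁻¹ i j) ∈ regSL3 K := by
  have h (i j k l i' j' k' l' : Fin 3) :
      (fun g : SL3 K => g i j * g k l - g i' j' * g k' l') ∈ regSL3 K :=
    sub_mem (mul_mem (entry_mem_regSL3 i j) (entry_mem_regSL3 k l))
      (mul_mem (entry_mem_regSL3 i' j') (entry_mem_regSL3 k' l'))
  have h' (i j k l i' j' k' l' : Fin 3) :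
      (fun g : SL3 K => -(g i j * g k l) + g i' j' * g k' l') ∈ regSL3 K :=
    add_mem (neg_mem (mul_mem (entry_mem_regSL3 i j) (entry_mem_regSL3 k l)))
      (mul_mem (entry_mem_regSL3 i' j') (entry_mem_regSL3 k' l'))
  fin_cases i <;> fin_cases j <;>
    simp [Matrix.SpecialLinearGroup.coe_inv, Matrix.adjugate_fin_three, h, h']

/-- Regular functions are preserved by substituting regular functions for the matrix entries. -/
theorem comp_mem_regSL3 {F : SL3 K → K} (hF : F ∈ regSL3 K) {σ : SL3 K → SL3 K}
    (hσ : ∀ i j, (fun g => σ g i j) ∈ regSL3 K) : (fun g => F (σ g)) ∈ regSL3 K := by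
  obtain ⟨p, rfl⟩ := hF
  change (fun g => restrict K p (σ g)) ∈ regSL3 K
  induction p using MvPolynomial.induction_on with
  | C a =>
    simp only [MvPolynomial.algHom_C]
    exact (regSL3 K).algebraMap_mem a
  | add p q hp hq =>
    simp only [map_add]
    exact add_mem hp hq
  | mul_X p ij hp =>
    have h : restrict K (MvPolynomial.X ij) = fun g => g ij.1 ij.2 := MvPolynomial.aeval_X _ _
    simp only [map_mul, h]
    exact mul_mem hp (hσ ij.1 ij.2)

theorem comp_inv_mem_regSL3 {F : SL3 K → K} (hF : F ∈ regSL3 K) :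
    (fun g => F g⁻¹) ∈ regSL3 K :=
  comp_mem_regSL3 hF inv_entry_mem_regSL3

theorem restrict_apply (p : MvPolynomial (Fin 3 × Fin 3) K) (g : SL3 K) :
    restrict K p g = MvPolynomial.eval (fun ij => g ij.1 ij.2) p := by
  induction p using MvPolynomial.induction_on with
  | C a => simp [restrict]
  | add p q hp hq => simp [hp, hq]
  | mul_X p ij hp =>
    rw [map_mul, Pi.mul_apply, hp]
    simp [restrict]

/-- The restriction of a polynomial in the matrix entries to the line `A + tB`. -/
noncomputable def onLine (A B : Matrix (Fin 3) (Fin 3) K) :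
    MvPolynomial (Fin 3 × Fin 3) K →ₐ[K] Polynomial K :=
  MvPolynomial.aeval fun ij =>
    Polynomial.C (A ij.1 ij.2) + Polynomial.C (B ij.1 ij.2) * Polynomial.X

theorem eval_onLine (A B : Matrix (Fin 3) (Fin 3) K) (p : MvPolynomial (Fin 3 × Fin 3) K) (t : K) :
    (onLine A B p).eval t = MvPolynomial.eval (fun ij => (A + t • B) ij.1 ij.2) p := by
  induction p using MvPolynomial.induction_on with
  | C a => simp [onLine]
  | add p q hp hq => simp [hp, hq]
  | mul_X p ij hp =>
    rw [map_mul, map_mul, Polynomial.eval_mul, hp]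
    simp [onLine, mul_comm t]

/-- The chain rule; it turns the sum of partial derivatives in `IsDifferential` into the derivative
of a polynomial in one variable. -/
theorem eval_zero_derivative_onLine (A B : Matrix (Fin 3) (Fin 3) K)
    (p : MvPolynomial (Fin 3 × Fin 3) K) :
    (onLine A B p).derivative.eval 0 = ∑ ij : Fin 3 × Fin 3, B ij.1 ij.2 *
      MvPolynomial.eval (fun kl => A kl.1 kl.2) (MvPolynomial.pderiv ij p) := by
  induction p using MvPolynomial.induction_on with
  | C a => simp [onLine]
  | add p q hp hq => simp [hp, hq, mul_add, Finset.sum_add_distrib]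
  | mul_X p kl hp =>
    have h0 : (onLine A B p).eval 0 = MvPolynomial.eval (fun ij => A ij.1 ij.2) p := by
      simpa using eval_onLine A B p 0
    rw [map_mul, Polynomial.derivative_mul, Polynomial.eval_add, Polynomial.eval_mul,
      Polynomial.eval_mul, hp, h0]
    simp only [Derivation.leibniz, MvPolynomial.pderiv_X, smul_eq_mul, map_add, map_mul, mul_add,
      Finset.sum_add_distrib, MvPolynomial.eval_X]
    rw [add_comm]
    congr 1
    · rw [Finset.sum_eq_single kl]
      · simp [onLine, mul_comm (B _ _)]
      · intro ij _ hij
        simp [hij.symm]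
      · simp
    · rw [Finset.sum_mul]
      refine Finset.sum_congr rfl fun ij _ => ?_
      simp [onLine]
      ring


theorem single_mul_single_self {i j : Fin 3} (h : i ≠ j) :
    Matrix.single i j (1 : K) * Matrix.single i j 1 = 0 :=
  Matrix.single_mul_single_of_ne (h := h.symm) ..

/-- The relation `∑ x_j ξ_j = 0`. It recovers `x₃` where `ξ₃ ≠ 0`, and it eliminates `x₃ξ₃` when
lowering operators are applied to monomials. -/
theorem sum_inv_mul_eq_zero (g : SL3 K) :
    g⁻¹ 2 0 * g 0 0 + g⁻¹ 2 1 * g 1 0 + g⁻¹ 2 2 * g 2 0 = 0 := by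
  have : (g⁻¹ * g : SL3 K) 2 0 = 0 := by simp
  rwa [Matrix.SpecialLinearGroup.coe_mul, Matrix.mul_apply, Fin.sum_univ_three] at this

theorem exists_col_ne_zero (g : SL3 K) (h : g 2 0 = 0) : g 0 0 ≠ 0 ∨ g 1 0 ≠ 0 := by
  by_contra! h'
  have := g.2
  rw [Matrix.det_fin_three] at this
  change g 2 0 = 0 at h
  simp [h, h'.1, h'.2] at this

theorem eq_zero_of_eval_mul_eval_eq_zero [Infinite K] {q r : Polynomial K} (hr : r ≠ 0)
    (h : ∀ t, r.eval t * q.eval t = 0) : q = 0 := by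
  have : r * q = 0 := Polynomial.funext fun t => by simpa using h t
  exact (mul_eq_zero.1 this).resolve_left hr

/-- The first column and the last row of `g⁻¹h` are those of the identity; the determinant then
forces the middle diagonal entry to be `1`. -/
theorem inv_mul_mem_U {g h : SL3 K} (hcol : ∀ i, g i 0 = h i 0)
    (hrow : ∀ j, g⁻¹ 2 j = h⁻¹ 2 j) : g⁻¹ * h ∈ U K := by
  have h1 (i : Fin 3) : (g⁻¹ * h : SL3 K) i 0 = (1 : SL3 K) i 0 := by
    rw [← inv_mul_cancel g]
    simp only [Matrix.SpecialLinearGroup.coe_mul, Matrix.mul_apply, hcol]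
  have h2 (j : Fin 3) : (g⁻¹ * h : SL3 K) 2 j = (1 : SL3 K) 2 j := by
    rw [← inv_mul_cancel h]
    simp only [Matrix.SpecialLinearGroup.coe_mul, Matrix.mul_apply, hrow]
  generalize g⁻¹ * h = m at h1 h2
  have a0 := h1 0
  have a1 := h1 1
  have a2 := h1 2
  have b1 := h2 1
  have b2 := h2 2
  simp only [Matrix.SpecialLinearGroup.coe_one, Matrix.one_apply, Fin.isValue, Fin.reduceEq,
    if_true, if_false] at a0 a1 a2 b1 b2
  have hd : m 1 1 = 1 := by
    have := m.2
    rw [Matrix.det_fin_three] at this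
    change m 0 0 * m 1 1 * m 2 2 - m 0 0 * m 1 2 * m 2 1 - m 0 1 * m 1 0 * m 2 2 +
      m 0 1 * m 1 2 * m 2 0 + m 0 2 * m 1 0 * m 2 1 - m 0 2 * m 1 1 * m 2 0 = 1 at this
    simpa [a0, a1, a2, b1, b2] using this
  constructor
  · intro i
    fin_cases i <;> assumption
  · intro i j hij
    fin_cases i <;> fin_cases j <;> first
      | exact absurd hij (by decide)
      | assumption

/-- A right `U`-invariant function depends only on the first column of `g` and the last row of
`g⁻¹`. -/
theorem eq_of_right_invariant {F : SL3 K → K} (hF : ∀ g : SL3 K, ∀ u ∈ U K, F (g * u) = F g)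
    {g h : SL3 K} (hcol : ∀ i, g i 0 = h i 0) (hrow : ∀ j, g⁻¹ 2 j = h⁻¹ 2 j) : F g = F h := by
  simpa using (hF g _ (inv_mul_mem_U hcol hrow)).symm

variable [CharZero K]

/-- `det (1 + N)` is `1 + tr N + e₂ + det N` with `e₂ = ((tr N)² - tr N²)/2`, and every term after
the `1` vanishes when `N² = 0`. -/
theorem det_one_add_of_mul_self_eq_zero {N : Matrix (Fin 3) (Fin 3) K} (hN : N * N = 0) :
    (1 + N).det = 1 := by
  have htr : N.trace = 0 :=
    (Matrix.isNilpotent_trace_of_isNilpotent ⟨2, by rw [pow_two, hN]⟩).eq_zero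
  have hdet : N.det = 0 := by
    have := congrArg Matrix.det hN
    simpa [Matrix.det_mul] using this
  have hsq : (N * N).trace = 0 := by simp [hN]
  simp only [Matrix.trace_fin_three, Matrix.mul_apply, Fin.sum_univ_three] at htr hsq
  rw [Matrix.det_fin_three] at hdet ⊢
  simp only [Matrix.add_apply, Matrix.one_apply, Fin.isValue, Fin.reduceEq, if_true, if_false]
  linear_combination hdet + htr + (1 / 2) * (N 0 0 + N 1 1 + N 2 2) * htr - (1 / 2) * hsq

/-- The element `1 + tN` of `SL₃`, for a matrix `N` with `N² = 0`. -/
def expNil {N : Matrix (Fin 3) (Fin 3) K} (hN : N * N = 0) (t : K) : SL3 K :=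
  ⟨1 + t • N, det_one_add_of_mul_self_eq_zero (by simp [hN])⟩

section

variable {N : Matrix (Fin 3) (Fin 3) K} (hN : N * N = 0)

@[simp] theorem coe_expNil (t : K) : (expNil hN t : Matrix (Fin 3) (Fin 3) K) = 1 + t • N := rfl

@[simp] theorem expNil_zero : expNil hN 0 = 1 := by
  ext i j
  simp

theorem expNil_add (s t : K) : expNil hN (s + t) = expNil hN s * expNil hN t := by
  apply Subtype.ext
  change 1 + (s + t) • N = (1 + s • N) * (1 + t • N)
  rw [add_mul, mul_add, mul_add, smul_mul_smul_comm, hN]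
  simp only [one_mul, mul_one, smul_zero, add_zero, add_smul]
  abel

theorem expNil_inv (t : K) : (expNil hN t)⁻¹ = expNil hN (-t) := by
  rw [inv_eq_iff_mul_eq_one, ← expNil_add, add_neg_cancel, expNil_zero]

/-- A regular function restricts to a polynomial on each line `t ↦ s (1 + tN) g`. -/
theorem exists_polynomial_expNil {F : SL3 K → K} (hF : F ∈ regSL3 K) (s g : SL3 K) :
    ∃ q : Polynomial K, ∀ t, F (s * expNil hN t * g) = q.eval t := by
  obtain ⟨p, rfl⟩ := hF
  refine ⟨onLine (s * g : SL3 K).1 (s.1 * N * g.1) p, fun t => ?_⟩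
  rw [AlgHom.toRingHom_eq_coe, RingHom.coe_coe, restrict_apply, eval_onLine]
  congr 2
  ext ij
  rw [Matrix.SpecialLinearGroup.coe_mul, Matrix.SpecialLinearGroup.coe_mul, coe_expNil,
    Matrix.SpecialLinearGroup.coe_mul]
  rw [Matrix.mul_add, Matrix.add_mul, Matrix.mul_one, Matrix.mul_smul, Matrix.smul_mul]

end

/-- The root subgroups `1 + tE_ij`. -/
abbrev root {i j : Fin 3} (h : i ≠ j) (t : K) : SL3 K := expNil (single_mul_single_self h) t

/-- The function `ξ₃` is not a zero divisor in the algebra of regular functions. -/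
theorem eq_zero_of_entry_mul_eq_zero {F : SL3 K → K} (hF : F ∈ regSL3 K)
    (h : ∀ g : SL3 K, g 2 0 * F g = 0) : F = 0 := by
  ext g
  by_cases hg : g 2 0 = 0
  -- At a point with `ξ₃ = 0`, move along `1 + tE_{3j}` with `g_{j1} ≠ 0`. There `ξ₃` equals `t
  -- g_{j1}`, so the polynomial `t ↦ F` is zero, in particular at `t = 0`.
  · have key (j : Fin 3) (hj : 2 ≠ j) (hne : g j 0 ≠ 0) : F g = 0 := by
      obtain ⟨q, hq⟩ := exists_polynomial_expNil (single_mul_single_self (K := K) hj) hF 1 g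
      have h0 : q = 0 := by
        refine eq_zero_of_eval_mul_eval_eq_zero (r := Polynomial.C (g j 0) * Polynomial.X)
          (by simpa using hne) fun t => ?_
        have := h (1 * root hj t * g)
        rw [hq] at this
        simpa [Matrix.add_mul, Matrix.smul_mul, hg, or_comm] using this
      simpa [h0] using hq 0
    obtain h' | h' := exists_col_ne_zero g hg
    · exact key 0 (by decide) h'
    · exact key 1 (by decide) h'
  · simpa [hg] using h g

theorem eq_zero_of_inv_entry_mul_eq_zero {F : SL3 K → K} (hF : F ∈ regSL3 K)
    (h : ∀ g : SL3 K, g⁻¹ 2 0 * F g = 0) : F = 0 := by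
  have := eq_zero_of_entry_mul_eq_zero (comp_inv_mem_regSL3 hF) fun g => by
    simpa using h g⁻¹
  ext g
  simpa using congrFun this g⁻¹

/-- Regular functions that agree on the big cell agree. -/
theorem eq_of_eqOn_bigCell {F F' : SL3 K → K} (hF : F ∈ regSL3 K) (hF' : F' ∈ regSL3 K)
    (h : ∀ g : SL3 K, g⁻¹ 2 0 ≠ 0 → g 2 0 ≠ 0 → F g = F' g) : F = F' := by
  have hd : F - F' ∈ regSL3 K := sub_mem hF hF'
  have h1 : (fun g : SL3 K => g⁻¹ 2 0) * (F - F') = 0 :=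
    eq_zero_of_entry_mul_eq_zero (mul_mem (inv_entry_mem_regSL3 2 0) hd) fun g => by
      by_cases h0 : g⁻¹ 2 0 = 0
      · simp [h0, -Matrix.SpecialLinearGroup.coe_inv]
      by_cases h3 : g 2 0 = 0
      · simp [h3]
      · simp [h g h0 h3]
  exact sub_eq_zero.1 (eq_zero_of_inv_entry_mul_eq_zero hd fun g => congrFun h1 g)

theorem root_mem_Uθ (h : (0 : Fin 3) ≠ 2) (t : K) : root h t ∈ Uθ K :=
  ⟨t, by simp [Matrix.transvection, Matrix.smul_single]⟩

/-- On `ξ₃ ≠ 0`, an invariant function depends only on the generators. -/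
theorem eq_of_generators_eq {F : SL3 K → K} (hF : F ∈ invAlgebra K) {g h : SL3 K}
    (hgen : ∀ i, generators K i g = generators K i h) (hg : g 2 0 ≠ 0) : F g = F h := by
  have e0 : g⁻¹ 2 0 = h⁻¹ 2 0 := hgen 0
  have e1 : g⁻¹ 2 1 = h⁻¹ 2 1 := hgen 1
  have e2 : g 1 0 = h 1 0 := hgen 2
  have e3 : g 2 0 = h 2 0 := hgen 3
  have h02 : (0 : Fin 3) ≠ 2 := by decide
  -- Left translation by `1 + sE₁₃` adds `s ξ₃` to `ξ₁` and fixes the four generators; this `s`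
  -- makes `ξ₁` agree with its value at `h`. The relation `∑ x_j ξ_j = 0` then makes `x₃` agree as
  -- well.
  set s : K := (h 0 0 - g 0 0) / g 2 0 with hs
  have hs' : s * g 2 0 = h 0 0 - g 0 0 := by rw [hs]; field_simp
  have hu : F (root h02 s * g) = F g := by
    have := hF.2 _ (inv_mem (root_mem_Uθ h02 s)) g
    simpa using this
  rw [← hu]
  have c0 : (root h02 s * g : SL3 K) 0 0 = h 0 0 := by
    simp [Matrix.add_mul, hs']
  have c1 : (root h02 s * g : SL3 K) 1 0 = h 1 0 := by
    simp [Matrix.add_mul, e2]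
  have c2 : (root h02 s * g : SL3 K) 2 0 = h 2 0 := by
    simp [Matrix.add_mul, e3]
  have r0 : (root h02 s * g : SL3 K)⁻¹ 2 0 = h⁻¹ 2 0 := by
    rw [mul_inv_rev, expNil_inv, ← e0]
    simp [Matrix.mul_add, -Matrix.SpecialLinearGroup.coe_inv]
  have r1 : (root h02 s * g : SL3 K)⁻¹ 2 1 = h⁻¹ 2 1 := by
    rw [mul_inv_rev, expNil_inv, ← e1]
    simp [Matrix.mul_add, -Matrix.SpecialLinearGroup.coe_inv]
  have r2 : (root h02 s * g : SL3 K)⁻¹ 2 2 = h⁻¹ 2 2 := by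
    have q1 := sum_inv_mul_eq_zero (root h02 s * g)
    have q2 := sum_inv_mul_eq_zero h
    rw [c0, c1, c2, r0, r1] at q1
    rw [e3] at hg
    exact mul_right_cancel₀ hg (by linear_combination q1 - q2)
  refine eq_of_right_invariant hF.1.2 (fun i => ?_) fun j => ?_
  · fin_cases i <;> assumption
  · fin_cases j <;> assumption

end RegularFunctions

/-! ### The algebra of `U_θ`-invariants is polynomial. -/

section Invariants

variable {K : Type*} [Field K]

theorem X_dvd_sub_aeval_update {σ : Type*} [DecidableEq σ] (i : σ)
    (P : MvPolynomial σ K) :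
    MvPolynomial.X i ∣ P - MvPolynomial.aeval (Function.update MvPolynomial.X i 0) P := by
  induction P using MvPolynomial.induction_on with
  | C a => simp [MvPolynomial.algebraMap_eq]
  | add p q hp hq =>
    rw [map_add, add_sub_add_comm]
    exact dvd_add hp hq
  | mul_X p j hp =>
    rw [map_mul, MvPolynomial.aeval_X]
    by_cases hj : j = i
    · subst hj
      simp
    · rw [Function.update_of_ne hj, ← sub_mul]
      exact hp.mul_right _

theorem eval_aeval_update_X {σ : Type*} [DecidableEq σ] (i : σ) (y : σ → K)
    (P : MvPolynomial σ K) :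
    MvPolynomial.eval y (MvPolynomial.aeval (Function.update MvPolynomial.X i 0) P)
      = MvPolynomial.eval (Function.update y i 0) P := by
  induction P using MvPolynomial.induction_on with
  | C a => simp
  | add p q hp hq => rw [map_add, map_add, hp, hq, map_add]
  | mul_X p j hp =>
    rw [map_mul, map_mul, hp, map_mul, MvPolynomial.aeval_X, MvPolynomial.eval_X]
    by_cases hj : j = i
    · subst hj
      simp
    · simp [hj]

/-- A polynomial that vanishes at the points with `y i = 0` and `y j ≠ 0` for `j ∈ s` is divisible
by the variable `X i`. -/
theorem X_dvd_of_eval_eq_zero [Infinite K] {σ : Type*} [DecidableEq σ] (i : σ)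
    (s : Finset σ) (hs : i ∉ s) (P : MvPolynomial σ K)
    (h : ∀ y : σ → K, y i = 0 → (∀ j ∈ s, y j ≠ 0) → MvPolynomial.eval y P = 0) :
    MvPolynomial.X i ∣ P := by
  have key : MvPolynomial.aeval (Function.update MvPolynomial.X i 0) P = (0 : MvPolynomial σ K) := by
    -- The points excluded by `s` are absorbed by this nonzero factor, which can be cancelled since
    -- the polynomial ring is a domain.
    have hprod : (∏ j ∈ s, MvPolynomial.X j : MvPolynomial σ K) ≠ 0 :=
      Finset.prod_ne_zero_iff.2 fun j _ => MvPolynomial.X_ne_zero (R := K) j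
    refine (mul_eq_zero.1 (MvPolynomial.funext fun y => ?_ :
      (∏ j ∈ s, MvPolynomial.X j : MvPolynomial σ K) *
        MvPolynomial.aeval (Function.update MvPolynomial.X i 0) P = 0)).resolve_left hprod
    rw [map_mul, eval_aeval_update_X, map_zero, map_prod]
    by_cases hy : ∀ j ∈ s, y j ≠ 0
    · rw [h _ (by simp) fun j hj => ?_, mul_zero]
      rw [Function.update_of_ne (by rintro rfl; exact hs hj)]
      exact hy j hj
    · push Not at hy
      obtain ⟨j, hj, hj0⟩ := hy
      rw [Finset.prod_eq_zero hj (by simpa using hj0), zero_mul]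
  have := X_dvd_sub_aeval_update i P
  rwa [key, sub_zero] at this

/-- A section of the map `g ↦ (x₁, x₂, ξ₂, ξ₃)` over `x₁ ≠ 0`, `ξ₃ ≠ 0`. -/
def cellSection (y : Fin 4 → K) (h0 : y 0 ≠ 0) (h3 : y 3 ≠ 0) : SL3 K :=
  ⟨!![0, y 1 / y 3, 1 / y 0; y 2, -y 0 / y 3, 0; y 3, 0, 0], by
    rw [Matrix.det_fin_three]
    change 0 * (-y 0 / y 3) * 0 - 0 * 0 * 0 - y 1 / y 3 * y 2 * 0 + y 1 / y 3 * 0 * y 3 +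
      1 / y 0 * y 2 * 0 - 1 / y 0 * (-y 0 / y 3) * y 3 = 1
    field_simp
    ring⟩

theorem inv_two_zero (g : SL3 K) : g⁻¹ 2 0 = g 1 0 * g 2 1 - g 1 1 * g 2 0 := by
  rw [Matrix.SpecialLinearGroup.coe_inv, Matrix.adjugate_fin_three]
  rfl

theorem inv_two_one (g : SL3 K) : g⁻¹ 2 1 = -(g 0 0 * g 2 1) + g 0 1 * g 2 0 := by
  rw [Matrix.SpecialLinearGroup.coe_inv, Matrix.adjugate_fin_three]
  rfl

theorem generators_cellSection (y : Fin 4 → K) (h0 : y 0 ≠ 0) (h3 : y 3 ≠ 0) (i : Fin 4) :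
    generators K i (cellSection y h0 h3) = y i := by
  fin_cases i
  · refine (inv_two_zero _).trans ?_
    change y 2 * 0 - -y 0 / y 3 * y 3 = y 0
    field_simp
    ring
  · refine (inv_two_one _).trans ?_
    change -(0 * 0) + y 1 / y 3 * y 3 = y 1
    field_simp
    ring
  · rfl
  · rfl

/-- `cellSection` has `y 0` in a denominator; this covers generic points of the hyperplane `x₁ = 0`,
as needed to cancel `x₁`. -/
theorem exists_generators_eq_of_x₁_eq_zero (y : Fin 4 → K) (h0 : y 0 = 0) (h1 : y 1 ≠ 0)
    (h3 : y 3 ≠ 0) : ∃ g : SL3 K, ∀ i, generators K i g = y i := by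
  refine ⟨⟨!![0, y 1 / y 3, 0; y 2, 0, 1 / y 1; y 3, 0, 0], ?_⟩, fun i => ?_⟩
  · rw [Matrix.det_fin_three]
    change 0 * 0 * 0 - 0 * (1 / y 1) * 0 - y 1 / y 3 * y 2 * 0 + y 1 / y 3 * (1 / y 1) * y 3 +
      0 * y 2 * 0 - 0 * 0 * y 3 = 1
    field_simp
    ring
  · fin_cases i
    · refine (inv_two_zero _).trans ?_
      change y 2 * 0 - 0 * y 3 = y 0
      rw [h0]
      ring
    · refine (inv_two_one _).trans ?_
      change -(0 * 0) + y 1 / y 3 * y 3 = y 1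
      field_simp
      ring
    · rfl
    · rfl

/-- The counterpart for `ξ₃ = 0`. Here the relation reads `x₁ξ₁ + x₂ξ₂ = 0`, which dictates the
upper left entry of the witness. -/
theorem exists_generators_eq_of_ξ₃_eq_zero (y : Fin 4 → K) (h0 : y 0 ≠ 0) (h2 : y 2 ≠ 0)
    (h3 : y 3 = 0) : ∃ g : SL3 K, ∀ i, generators K i g = y i := by
  refine ⟨⟨!![-(y 1 * y 2) / y 0, 0, 1 / y 0; y 2, 0, 0; 0, y 0 / y 2, 0], ?_⟩, fun i => ?_⟩
  · rw [Matrix.det_fin_three]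
    change -(y 1 * y 2) / y 0 * 0 * 0 - -(y 1 * y 2) / y 0 * 0 * (y 0 / y 2) - 0 * y 2 * 0 +
      0 * 0 * 0 + 1 / y 0 * y 2 * (y 0 / y 2) - 1 / y 0 * 0 * 0 = 1
    field_simp
    ring
  · fin_cases i
    · refine (inv_two_zero _).trans ?_
      change y 2 * (y 0 / y 2) - 0 * 0 = y 0
      field_simp
      ring
    · refine (inv_two_one _).trans ?_
      change -(-(y 1 * y 2) / y 0 * (y 0 / y 2)) + 0 * 0 = y 1
      field_simp
      ring
    · rfl
    · exact h3.symm

theorem aeval_generators_apply (P : MvPolynomial (Fin 4) K) (g : SL3 K) :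
    MvPolynomial.aeval (generators K) P g = MvPolynomial.eval (fun i => generators K i g) P := by
  induction P using MvPolynomial.induction_on with
  | C a => simp
  | add p q hp hq => simp [hp, hq]
  | mul_X p i hp =>
    rw [map_mul, Pi.mul_apply, hp]
    simp

theorem generators_mem_regSL3 (i : Fin 4) : generators K i ∈ regSL3 K := by
  fin_cases i
  · exact inv_entry_mem_regSL3 2 0
  · exact inv_entry_mem_regSL3 2 1
  · exact entry_mem_regSL3 1 0
  · exact entry_mem_regSL3 2 0

theorem aeval_generators_mem_regSL3 (P : MvPolynomial (Fin 4) K) :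
    MvPolynomial.aeval (generators K) P ∈ regSL3 K := by
  have : MvPolynomial.aeval (generators K) P ∈ Algebra.adjoin K (Set.range (generators K)) := by
    rw [Algebra.adjoin_range_eq_range_aeval]
    exact ⟨P, rfl⟩
  exact Algebra.adjoin_le (by rintro _ ⟨i, rfl⟩; exact generators_mem_regSL3 i) this

theorem generators_mem_invAlgebra (i : Fin 4) : generators K i ∈ invAlgebra K := by
  have hrow (j : Fin 3) (g u : SL3 K) (hu : u ∈ U K) : (g * u)⁻¹ 2 j = g⁻¹ 2 j := by
    have hu' := inv_mem hu
    rw [mul_inv_rev, Matrix.SpecialLinearGroup.coe_mul, Matrix.mul_apply, Fin.sum_univ_three,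
      hu'.1 2, hu'.2 2 0 (by decide), hu'.2 2 1 (by decide)]
    ring
  have hcol (i : Fin 3) (g u : SL3 K) (hu : u ∈ U K) : (g * u) i 0 = g i 0 := by
    rw [Matrix.SpecialLinearGroup.coe_mul, Matrix.mul_apply, Fin.sum_univ_three,
      hu.1 0, hu.2 1 0 (by decide), hu.2 2 0 (by decide)]
    ring
  have hrow' (j : Fin 3) (hj : j ≠ 2) (u g : SL3 K) (hu : u ∈ Uθ K) :
      (u⁻¹ * g)⁻¹ 2 j = g⁻¹ 2 j := by
    obtain ⟨s, hs⟩ := hu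
    rw [mul_inv_rev, inv_inv, Matrix.SpecialLinearGroup.coe_mul, hs]
    simp [Matrix.transvection, Matrix.mul_add, hj, -Matrix.SpecialLinearGroup.coe_inv]
  have hcol' (i : Fin 3) (hi : i ≠ 0) (u g : SL3 K) (hu : u ∈ Uθ K) : (u⁻¹ * g) i 0 = g i 0 := by
    obtain ⟨s, hs⟩ := inv_mem hu
    rw [Matrix.SpecialLinearGroup.coe_mul, hs]
    simp [Matrix.transvection, Matrix.add_mul, hi]
  refine ⟨⟨generators_mem_regSL3 i, fun g u hu => ?_⟩, fun u hu g => ?_⟩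
  · fin_cases i
    · exact hrow 0 g u hu
    · exact hrow 1 g u hu
    · exact hcol 1 g u hu
    · exact hcol 2 g u hu
  · fin_cases i
    · exact hrow' 0 (by decide) u g hu
    · exact hrow' 1 (by decide) u g hu
    · exact hcol' 1 (by decide) u g hu
    · exact hcol' 2 (by decide) u g hu

/-- The entries of `cellSection` become polynomials after multiplication by `y₀y₃`, so a polynomial
in them needs only a power of `y₀y₃` as denominator. -/
theorem exists_eval_eq_pow_mul_cellSection (p : MvPolynomial (Fin 3 × Fin 3) K) :
    ∃ (N : ℕ) (P : MvPolynomial (Fin 4) K), ∀ (y : Fin 4 → K) (h0 : y 0 ≠ 0) (h3 : y 3 ≠ 0),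
      MvPolynomial.eval y P = (y 0 * y 3) ^ N * restrict K p (cellSection y h0 h3) := by
  induction p using MvPolynomial.induction_on with
  | C a => exact ⟨0, MvPolynomial.C a, fun y h0 h3 => by simp [restrict_apply]⟩
  | add p q hp hq =>
    obtain ⟨N, P, hP⟩ := hp
    obtain ⟨M, Q, hQ⟩ := hq
    refine ⟨N + M, (MvPolynomial.X 0 * MvPolynomial.X 3) ^ M * P +
      (MvPolynomial.X 0 * MvPolynomial.X 3) ^ N * Q, fun y h0 h3 => ?_⟩
    simp only [map_add, map_mul, map_pow, MvPolynomial.eval_X, hP y h0 h3, hQ y h0 h3,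
      Pi.add_apply]
    ring
  | mul_X p ij hp =>
    obtain ⟨N, P, hP⟩ := hp
    have key : ∃ Q : MvPolynomial (Fin 4) K, ∀ (y : Fin 4 → K) (h0 : y 0 ≠ 0) (h3 : y 3 ≠ 0),
        MvPolynomial.eval y Q = y 0 * y 3 * cellSection y h0 h3 ij.1 ij.2 := by
      let Y : Fin 4 → MvPolynomial (Fin 4) K := MvPolynomial.X
      -- This matrix is `y₀y₃` times the matrix of `cellSection`.
      refine ⟨!![0, Y 1 * Y 0, Y 3; Y 2 * (Y 0 * Y 3), -Y 0 ^ 2, 0; Y 0 * Y 3 ^ 2, 0, 0]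
        ij.1 ij.2, fun y h0 h3 => ?_⟩
      obtain ⟨i, j⟩ := ij
      fin_cases i <;> fin_cases j <;> simp [Y, cellSection] <;> field_simp
    obtain ⟨Q, hQ⟩ := key
    refine ⟨N + 1, P * Q, fun y h0 h3 => ?_⟩
    rw [map_mul, hP y h0 h3, hQ y h0 h3, map_mul, Pi.mul_apply, restrict_apply (.X ij),
      MvPolynomial.eval_X]
    ring

variable [CharZero K]

/-- By `cellSection` the generators take all values with `y₀, y₃ ≠ 0`. A relation multiplied by
`X₀X₃` therefore vanishes on all of `K⁴`. -/
theorem algebraicIndependent_generators : AlgebraicIndependent K (generators K) := by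
  refine (algebraicIndependent_iff).2 fun P hP => ?_
  refine (mul_eq_zero.1 (MvPolynomial.funext fun y => ?_ :
    MvPolynomial.X 0 * MvPolynomial.X 3 * P = 0)).resolve_left
      (mul_ne_zero (MvPolynomial.X_ne_zero 0) (MvPolynomial.X_ne_zero 3))
  by_cases h0 : y 0 = 0
  · simp [h0]
  by_cases h3 : y 3 = 0
  · simp [h3]
  have := congrFun hP (cellSection y h0 h3)
  rw [aeval_generators_apply] at this
  simp only [generators_cellSection, Pi.zero_apply] at this
  simp [this]

/-- Removing a power of a generator `X i` that is not a zero divisor from the denominator. -/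
theorem exists_aeval_generators_of_pow_mul (i : Fin 4) (s : Finset (Fin 4)) (hs : i ∉ s)
    (hsec : ∀ y : Fin 4 → K, y i = 0 → (∀ j ∈ s, y j ≠ 0) →
      ∃ g : SL3 K, ∀ j, generators K j g = y j)
    (hreg : ∀ F ∈ regSL3 K, generators K i * F = 0 → F = 0) {F : SL3 K → K} (hF : F ∈ regSL3 K) :
    ∀ (N : ℕ) (P : MvPolynomial (Fin 4) K),
      MvPolynomial.aeval (generators K) P = generators K i ^ N * F →
      ∃ Q : MvPolynomial (Fin 4) K, MvPolynomial.aeval (generators K) Q = F := by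
  intro N
  induction N with
  | zero => exact fun P hP => ⟨P, by simpa using hP⟩
  | succ N ih =>
    intro P hP
    -- The exponent is `N + 1`, so the right side vanishes with the `i`-th generator; by `hsec` this
    -- makes `P` vanish at generic points of `X i = 0`.
    obtain ⟨Q, rfl⟩ : MvPolynomial.X i ∣ P := by
      refine X_dvd_of_eval_eq_zero i s hs P fun y hy hys => ?_
      obtain ⟨g, hg⟩ := hsec y hy hys
      have := congrFun hP g
      rw [aeval_generators_apply] at this
      simpa [hg, hy] using this
    refine ih Q (sub_eq_zero.1 (hreg _ (sub_mem ?_ ?_) ?_))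
    · exact aeval_generators_mem_regSL3 Q
    · exact mul_mem (pow_mem (generators_mem_regSL3 i) _) hF
    · rw [mul_sub, ← mul_assoc, ← pow_succ', ← hP, map_mul, MvPolynomial.aeval_X, sub_self]

/-- On the big cell `F` equals its value on the section, a polynomial over `(x₁ξ₃)^N`. The powers of
`x₁` and of `ξ₃` are cancelled separately. -/
theorem exists_aeval_generators_eq {F : SL3 K → K} (hF : F ∈ invAlgebra K) :
    ∃ P : MvPolynomial (Fin 4) K, MvPolynomial.aeval (generators K) P = F := by
  obtain ⟨p, hp⟩ := hF.1.1
  obtain ⟨N, P, hP⟩ := exists_eval_eq_pow_mul_cellSection p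
  have hF3 : generators K 3 ^ N * F ∈ regSL3 K :=
    mul_mem (pow_mem (generators_mem_regSL3 3) _) hF.1.1
  have key : MvPolynomial.aeval (generators K) P
      = generators K 0 ^ N * (generators K 3 ^ N * F) := by
    refine eq_of_eqOn_bigCell (aeval_generators_mem_regSL3 P)
      (mul_mem (pow_mem (generators_mem_regSL3 0) _) hF3) fun g h0 h3 => ?_
    have h0' : generators K 0 g ≠ 0 := h0
    have h3' : generators K 3 g ≠ 0 := h3
    have h := hP (fun i => generators K i g) h0' h3'
    have hg : F g = F (cellSection (fun i => generators K i g) h0' h3') :=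
      eq_of_generators_eq hF (fun i => (generators_cellSection (fun i => generators K i g) h0' h3' i).symm) h3
    rw [aeval_generators_apply, h, Pi.mul_apply, Pi.mul_apply, Pi.pow_apply, Pi.pow_apply, hg,
      ← hp, mul_pow, mul_assoc]
    rfl
  obtain ⟨P', hP'⟩ := exists_aeval_generators_of_pow_mul 0 {1, 3} (by decide)
    (fun y h0 hy => exists_generators_eq_of_x₁_eq_zero y h0 (hy 1 (by simp)) (hy 3 (by simp)))
    (fun F hF h => eq_zero_of_inv_entry_mul_eq_zero hF (congrFun h)) hF3 N P key
  exact exists_aeval_generators_of_pow_mul 3 {0, 2} (by decide)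
    (fun y h3 hy => exists_generators_eq_of_ξ₃_eq_zero y (hy 0 (by simp)) (hy 2 (by simp)) h3)
    (fun F hF h => eq_zero_of_entry_mul_eq_zero hF (congrFun h)) hF.1.1 N P' hP'

theorem adjoin_generators : Algebra.adjoin K (Set.range (generators K)) = invAlgebra K := by
  refine le_antisymm (Algebra.adjoin_le ?_) fun F hF => ?_
  · rintro _ ⟨i, rfl⟩
    exact generators_mem_invAlgebra i
  · rw [Algebra.adjoin_range_eq_range_aeval]
    exact exists_aeval_generators_eq hF

theorem ringKrullDim_invAlgebra : ringKrullDim (invAlgebra K) = 4 := by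
  rw [← adjoin_generators,
    ← ringKrullDim_eq_of_ringEquiv (algebraicIndependent_generators (K := K)).aevalEquiv.toRingEquiv,
    MvPolynomial.ringKrullDim_of_isNoetherianRing, ringKrullDim_eq_zero_of_field]
  simp

end Invariants

/-! ### The differential of a rational representation, by means of square-zero matrices. -/

section Differential

variable {K : Type*} [Field K]

theorem trace_eq_zero (X : sl3 K) : X.1.trace = 0 := X.2

/-- Besides the `E_ij`, the matrices `E_ii - E_jj - E_ij + E_ji` have square zero; together they
yield the diagonal traceless matrices. -/
theorem mem_span_sq_eq_zero {X : Matrix (Fin 3) (Fin 3) K} (hX : X.trace = 0) :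
    X ∈ Submodule.span K {N : Matrix (Fin 3) (Fin 3) K | N * N = 0} := by
  set S := Submodule.span K {N : Matrix (Fin 3) (Fin 3) K | N * N = 0} with hS
  have h1 (i j : Fin 3) (hij : i ≠ j) : Matrix.single i j (1 : K) ∈ S :=
    Submodule.subset_span (single_mul_single_self hij)
  have h2 (i j : Fin 3) (hij : i ≠ j) :
      Matrix.single i i (1 : K) - Matrix.single j j (1 : K) ∈ S := by
    have : Matrix.single i i (1 : K) - Matrix.single j j (1 : K) - Matrix.single i j 1
        + Matrix.single j i 1 ∈ S := by
      refine Submodule.subset_span ?_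
      have h := hij.symm
      simp only [Set.mem_ofPred_eq, mul_add, mul_sub, add_mul, sub_mul,
        Matrix.single_mul_single_same]
      simp [hij, h]
      abel
    have := S.add_mem this (S.sub_mem (h1 i j hij) (h1 j i hij.symm))
    convert this using 1
    abel
  have key : X = X 0 1 • Matrix.single 0 1 (1 : K) + X 0 2 • Matrix.single 0 2 (1 : K)
      + X 1 0 • Matrix.single 1 0 (1 : K) + X 1 2 • Matrix.single 1 2 (1 : K)
      + X 2 0 • Matrix.single 2 0 (1 : K) + X 2 1 • Matrix.single 2 1 (1 : K)
      + X 0 0 • (Matrix.single 0 0 (1 : K) - Matrix.single 1 1 (1 : K))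
      - X 2 2 • (Matrix.single 1 1 (1 : K) - Matrix.single 2 2 (1 : K)) := by
    rw [Matrix.trace_fin_three] at hX
    have : X 1 1 = -X 0 0 - X 2 2 := by linear_combination hX
    ext i j
    fin_cases i <;> fin_cases j <;> simp [this]
  rw [key]
  have h01 : (0 : Fin 3) ≠ 1 := by decide
  have h02 : (0 : Fin 3) ≠ 2 := by decide
  have h12 : (1 : Fin 3) ≠ 2 := by decide
  refine S.sub_mem (S.add_mem (S.add_mem (S.add_mem (S.add_mem (S.add_mem (S.add_mem
    ?_ ?_) ?_) ?_) ?_) ?_) ?_) ?_ <;> refine S.smul_mem _ ?_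
  exacts [h1 _ _ h01, h1 _ _ h02, h1 _ _ h01.symm, h1 _ _ h12, h1 _ _ h02.symm, h1 _ _ h12.symm,
    h2 _ _ h01, h2 _ _ h12]

theorem trace_eq_zero_of_sq_eq_zero {N : Matrix (Fin 3) (Fin 3) K} (hN : N * N = 0) :
    N.trace = 0 :=
  (Matrix.isNilpotent_trace_of_isNilpotent ⟨2, by rw [pow_two, hN]⟩).eq_zero

/-- To compare two linear maps on `sl₃` it suffices to compare them on matrices of square zero. -/
theorem sl3_linearMap_ext {M : Type*} [AddCommGroup M] [Module K M] {f f' : sl3 K →ₗ[K] M}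
    (h : ∀ N : sl3 K, N.1 * N.1 = 0 → f N = f' N) : f = f' := by
  have key : ∀ (X : Matrix (Fin 3) (Fin 3) K),
      X ∈ Submodule.span K {N : Matrix (Fin 3) (Fin 3) K | N * N = 0} →
      ∀ hX : X ∈ sl3 K, f ⟨X, hX⟩ = f' ⟨X, hX⟩ := by
    intro X hX
    have hs (Y) (hY : Y ∈ Submodule.span K {N : Matrix (Fin 3) (Fin 3) K | N * N = 0}) :
        Y ∈ sl3 K := by
      have : Submodule.span K {N : Matrix (Fin 3) (Fin 3) K | N * N = 0}
          ≤ (sl3 K).toSubmodule :=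
        Submodule.span_le.2 fun N hN => trace_eq_zero_of_sq_eq_zero hN
      exact this hY
    induction hX using Submodule.span_induction with
    | mem N hN => exact fun hX => h ⟨N, hX⟩ hN
    | zero => exact fun hX => (map_zero f).trans (map_zero f').symm
    | add x y hx hy ihx ihy =>
      intro hX
      have := congrArg₂ (· + ·) (ihx (hs x hx)) (ihy (hs y hy))
      simp only [← map_add] at this
      exact this
    | smul c x hx ihx =>
      intro hX
      have := congrArg (c • ·) (ihx (hs x hx))
      simp only [← map_smul] at this
      exact this
  ext X
  exact key X.1 (mem_span_sq_eq_zero (trace_eq_zero X)) X.2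

/-- The derivative of a polynomial at the identity matrix. -/
noncomputable def derivAtOne : MvPolynomial (Fin 3 × Fin 3) K →ₗ[K] sl3 K →ₗ[K] K :=
  LinearMap.mk₂ K (fun p X => ∑ ij : Fin 3 × Fin 3, X.1 ij.1 ij.2 *
      MvPolynomial.eval (fun kl => (1 : Matrix (Fin 3) (Fin 3) K) kl.1 kl.2)
        (MvPolynomial.pderiv ij p))
    (fun p q X => by simp [mul_add, Finset.sum_add_distrib])
    (fun c p X => by simp [Finset.mul_sum, mul_left_comm])
    (fun p X Y => by simp [add_mul, Finset.sum_add_distrib])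
    (fun c p X => by simp [Finset.mul_sum, mul_assoc])

theorem derivAtOne_apply (p : MvPolynomial (Fin 3 × Fin 3) K) (X : sl3 K) :
    derivAtOne p X = (onLine 1 X.1 p).derivative.eval 0 :=
  (eval_zero_derivative_onLine 1 X.1 p).symm

variable {V : Type*} [AddCommGroup V] [Module K V]

/-- `d` is the differential at `1` of `ρ`, without the assumption that it is a homomorphism of Lie
algebras. -/
def IsLinearDifferential (ρ : Representation K (SL3 K) V) (d : sl3 K →ₗ[K] Module.End K V) : Prop :=
  ∀ (φ : Module.Dual K V) (v : V) (p : MvPolynomial (Fin 3 × Fin 3) K),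
    restrict K p = (fun g => φ (ρ g v)) → ∀ X : sl3 K, φ (d X v) = derivAtOne p X

theorem IsDifferential.isLinearDifferential {ρ : Representation K (SL3 K) V} {D : sl3 K →ₗ⁅K⁆ Module.End K V}
    (hD : IsDifferential ρ D) : IsLinearDifferential ρ (D : sl3 K →ₗ[K] Module.End K V) := hD

variable [CharZero K]

theorem onLine_one_eval {N : Matrix (Fin 3) (Fin 3) K} (hN : N * N = 0)
    (p : MvPolynomial (Fin 3 × Fin 3) K) (t : K) :
    (onLine 1 N p).eval t = restrict K p (expNil hN t) := by
  rw [eval_onLine, restrict_apply, coe_expNil]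

/-- The derivative at the identity depends only on the restriction to `SL₃`. -/
theorem derivAtOne_eq_of_restrict_eq {p q : MvPolynomial (Fin 3 × Fin 3) K}
    (h : restrict K p = restrict K q) : derivAtOne p = derivAtOne q := by
  refine sl3_linearMap_ext fun N hN => ?_
  rw [derivAtOne_apply, derivAtOne_apply]
  congr 2
  exact Polynomial.funext fun t => by rw [onLine_one_eval hN, onLine_one_eval hN, h]

/-- Differentiate chosen polynomials for the matrix entries of `ρ` in a basis. Any other polynomial
for a matrix coefficient has the same derivative by `derivAtOne_eq_of_restrict_eq`. -/
theorem exists_isLinearDifferential [FiniteDimensional K V] {ρ : Representation K (SL3 K) V}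
    (hρ : ∀ (φ : Module.Dual K V) (v : V), (fun g => φ (ρ g v)) ∈ regSL3 K) :
    ∃ d : sl3 K →ₗ[K] Module.End K V, IsLinearDifferential ρ d := by
  let b := Module.finBasis K V
  choose p hp using fun i j => hρ (b.coord i) (b j)
  have hp (i j) : restrict K (p i j) = fun g => b.coord i (ρ g (b j)) := hp i j
  let d : sl3 K →ₗ[K] Module.End K V := ∑ i, ∑ j,
    (derivAtOne (p i j)).smulRight (LinearMap.smulRight (b.coord j) (b i))
  refine ⟨d, fun φ v q hq X => ?_⟩
  have hq' : restrict K q = restrict K (∑ i, ∑ j, (φ (b i) * b.coord j v) • p i j) := by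
    ext g
    simp only [map_sum, map_smul, hp, hq, Finset.sum_apply, Pi.smul_apply]
    conv_lhs => rw [← b.sum_repr v, map_sum, map_sum]
    rw [Finset.sum_comm]
    refine Finset.sum_congr rfl fun j _ => ?_
    conv_lhs => rw [map_smul, ← b.sum_repr (ρ g (b j)), map_smul, map_sum, Finset.smul_sum]
    refine Finset.sum_congr rfl fun i _ => ?_
    simp only [map_smul, smul_eq_mul, Module.Basis.coord_apply]
    ring
  rw [derivAtOne_eq_of_restrict_eq hq']
  simp only [d, map_sum, LinearMap.sum_apply, LinearMap.smulRight_apply, LinearMap.smul_apply,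
    map_smul, smul_eq_mul]
  refine Finset.sum_congr rfl fun i _ => Finset.sum_congr rfl fun j _ => ?_
  ring


variable {ρ : Representation K (SL3 K) V}

theorem exists_polynomial_matrixCoeff
    (hρ : ∀ (φ : Module.Dual K V) (v : V), (fun g => φ (ρ g v)) ∈ regSL3 K)
    {N : Matrix (Fin 3) (Fin 3) K} (hN : N * N = 0)
    (φ : Module.Dual K V) (v : V) : ∃ q : Polynomial K, ∀ t, φ (ρ (expNil hN t) v) = q.eval t := by
  obtain ⟨q, hq⟩ := exists_polynomial_expNil hN (hρ φ v) 1 1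
  exact ⟨q, fun t => by simpa using hq t⟩

namespace IsLinearDifferential

variable {d : sl3 K →ₗ[K] Module.End K V}

/-- The line `1 + tN` stays inside `SL₃`, so only the values of the matrix coefficient on this
one-parameter subgroup matter. -/
theorem apply_of_sq_eq_zero (hd : IsLinearDifferential ρ d)
    (hρ : ∀ (φ : Module.Dual K V) (v : V), (fun g => φ (ρ g v)) ∈ regSL3 K)
    {N : sl3 K} (hN : N.1 * N.1 = 0) {φ : Module.Dual K V} {v : V} {q : Polynomial K}
    (hq : ∀ t, φ (ρ (expNil hN t) v) = q.eval t) : φ (d N v) = q.derivative.eval 0 := by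
  obtain ⟨p, hp⟩ := hρ φ v
  rw [hd φ v p hp N, derivAtOne_apply]
  congr 2
  refine Polynomial.funext fun t => ?_
  rw [onLine_one_eval hN, ← hq]
  exact congrFun hp _

/-- For `N² = 0` one has `g(1 + tN) = (1 + t gNg⁻¹)g`; compare derivatives at `t = 0` and extend
linearly. -/
theorem conj (hd : IsLinearDifferential ρ d)
    (hρ : ∀ (φ : Module.Dual K V) (v : V), (fun g => φ (ρ g v)) ∈ regSL3 K)
    (g : SL3 K) (X : sl3 K) (Y : sl3 K) (hY : Y.1 = g.1 * X.1 * (g⁻¹ : SL3 K).1) (v : V) :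
    ρ g (d X v) = d Y (ρ g v) := by
  have hmem (Z : sl3 K) : g.1 * Z.1 * (g⁻¹ : SL3 K).1 ∈ sl3 K := by
    change (g.1 * Z.1 * (g⁻¹ : SL3 K).1).trace = 0
    rw [Matrix.trace_mul_comm, ← Matrix.mul_assoc, ← Matrix.SpecialLinearGroup.coe_mul,
      inv_mul_cancel, Matrix.SpecialLinearGroup.coe_one, Matrix.one_mul]
    exact trace_eq_zero Z
  let Ad : sl3 K →ₗ[K] sl3 K :=
    { toFun := fun Z => ⟨_, hmem Z⟩
      map_add' := fun Z Z' => Subtype.ext (by simp [Matrix.mul_add, Matrix.add_mul])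
      map_smul' := fun c Z => Subtype.ext (by simp) }
  have hYAd : Y = Ad X := Subtype.ext hY
  rw [hYAd]
  have key : (LinearMap.mulLeft K (ρ g : Module.End K V)) ∘ₗ d
      = (LinearMap.mulRight K (ρ g : Module.End K V)) ∘ₗ d ∘ₗ Ad := by
    refine sl3_linearMap_ext fun N hN => ?_
    ext w
    refine sub_eq_zero.1 ((Module.forall_dual_apply_eq_zero_iff K _).1 fun φ => ?_)
    have hN' : (Ad N).1 * (Ad N).1 = 0 := by
      change g.1 * N.1 * (g⁻¹ : SL3 K).1 * (g.1 * N.1 * (g⁻¹ : SL3 K).1) = 0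
      have : (g⁻¹ : SL3 K).1 * g.1 = 1 := by
        rw [← Matrix.SpecialLinearGroup.coe_mul, inv_mul_cancel, Matrix.SpecialLinearGroup.coe_one]
      calc _ = g.1 * N.1 * ((g⁻¹ : SL3 K).1 * g.1) * N.1 * (g⁻¹ : SL3 K).1 := by noncomm_ring
        _ = g.1 * (N.1 * N.1) * (g⁻¹ : SL3 K).1 := by rw [this]; noncomm_ring
        _ = 0 := by rw [hN]; simp
    have hexp (t : K) : g * expNil hN t = expNil hN' t * g := by
      apply Subtype.ext
      rw [Matrix.SpecialLinearGroup.coe_mul, Matrix.SpecialLinearGroup.coe_mul, coe_expNil,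
        coe_expNil]
      change g.1 * (1 + t • N.1) = (1 + t • (g.1 * N.1 * (g⁻¹ : SL3 K).1)) * g.1
      have : (g⁻¹ : SL3 K).1 * g.1 = 1 := by
        rw [← Matrix.SpecialLinearGroup.coe_mul, inv_mul_cancel, Matrix.SpecialLinearGroup.coe_one]
      rw [Matrix.mul_add, Matrix.add_mul, Matrix.smul_mul, Matrix.mul_assoc _ _ g.1, this]
      simp
    obtain ⟨q, hq⟩ := exists_polynomial_matrixCoeff hρ hN (φ ∘ₗ ρ g) w
    have h1 := hd.apply_of_sq_eq_zero hρ hN hq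
    have h2 := hd.apply_of_sq_eq_zero hρ hN' (φ := φ) (v := ρ g w) (q := q) fun t => by
      rw [← hq, ← Module.End.mul_apply, ← map_mul, ← hexp, map_mul]
      rfl
    change φ (ρ g (d N w) - d (Ad N) (ρ g w)) = 0
    rw [map_sub, h2]
    exact sub_eq_zero.2 h1
  exact LinearMap.congr_fun (LinearMap.congr_fun key X) v

/-- With `Y` fixed it suffices to take `X = N` of square zero. Conjugating `Y` by `1 + tN` gives
exactly `Y + t[N,Y] - t²NYN`, and the coefficients of `t` in the resulting polynomial identity give
the bracket formula. -/
theorem map_lie (hd : IsLinearDifferential ρ d)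
    (hρ : ∀ (φ : Module.Dual K V) (v : V), (fun g => φ (ρ g v)) ∈ regSL3 K) (X Y : sl3 K) :
    d ⁅X, Y⁆ = d X * d Y - d Y * d X := by
  have key : d ∘ₗ (LieModule.toEnd K (sl3 K) (sl3 K)).toLinearMap.flip Y
      = LinearMap.mulRight K (d Y) ∘ₗ d - LinearMap.mulLeft K (d Y) ∘ₗ d := by
    refine sl3_linearMap_ext fun N hN => ?_
    ext v
    refine sub_eq_zero.1 ((Module.forall_dual_apply_eq_zero_iff K _).1 fun φ => ?_)
    have htr : N.1 * Y.1 * N.1 ∈ sl3 K := by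
      change (N.1 * Y.1 * N.1).trace = 0
      rw [Matrix.trace_mul_comm, ← Matrix.mul_assoc, hN]
      simp
    set Z : sl3 K := ⟨_, htr⟩
    have hconj (t : K) : ρ (expNil hN t) (d Y v)
        = d (Y + t • ⁅N, Y⁆ - t ^ 2 • Z) (ρ (expNil hN t) v) := by
      refine hd.conj hρ _ _ _ ?_ v
      rw [expNil_inv]
      change Y.1 + t • (N.1 * Y.1 - Y.1 * N.1) - t ^ 2 • (N.1 * Y.1 * N.1)
        = (1 + t • N.1) * Y.1 * (1 + -t • N.1)
      simp only [add_mul, mul_add, one_mul, mul_one, neg_smul, mul_neg, Matrix.smul_mul,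
        Matrix.mul_smul, smul_smul, smul_sub, pow_two]
      abel
    obtain ⟨q, hq⟩ := exists_polynomial_matrixCoeff hρ hN φ (d Y v)
    obtain ⟨q₀, h₀⟩ := exists_polynomial_matrixCoeff hρ hN (φ ∘ₗ d Y) v
    obtain ⟨q₁, h₁⟩ := exists_polynomial_matrixCoeff hρ hN (φ ∘ₗ d ⁅N, Y⁆) v
    obtain ⟨q₂, h₂⟩ := exists_polynomial_matrixCoeff hρ hN (φ ∘ₗ d Z) v
    have hpoly : q = q₀ + Polynomial.X * q₁ - Polynomial.X ^ 2 * q₂ := by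
      refine Polynomial.funext fun t => ?_
      rw [← hq, hconj]
      simp only [map_add, map_sub, map_smul, LinearMap.add_apply, LinearMap.sub_apply,
        LinearMap.smul_apply, Polynomial.eval_add, Polynomial.eval_sub, Polynomial.eval_mul,
        Polynomial.eval_pow, Polynomial.eval_X, ← h₀, ← h₁, ← h₂, smul_eq_mul,
        LinearMap.comp_apply]
    have e := hd.apply_of_sq_eq_zero hρ hN hq
    have e₀ := hd.apply_of_sq_eq_zero hρ hN h₀
    have e₁ : φ (d ⁅N, Y⁆ v) = q₁.eval 0 := by simpa using h₁ 0
    rw [hpoly] at e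
    simp only [Polynomial.derivative_add, Polynomial.derivative_sub, Polynomial.derivative_mul,
      Polynomial.derivative_X_pow, Polynomial.derivative_X, Polynomial.eval_add,
      Polynomial.eval_sub, Polynomial.eval_mul, ← e₀, ← e₁] at e
    change φ (d ⁅N, Y⁆ v - (d N (d Y v) - d Y (d N v))) = 0
    rw [map_sub, map_sub, e]
    simp
  exact LinearMap.congr_fun key X

theorem apply_expNil (hd : IsLinearDifferential ρ d)
    (hρ : ∀ (φ : Module.Dual K V) (v : V), (fun g => φ (ρ g v)) ∈ regSL3 K)
    {N : sl3 K} (hN : N.1 * N.1 = 0) (s : K) (v : V) :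
    d N (ρ (expNil hN s) v) = ρ (expNil hN s) (d N v) := by
  refine (hd.conj hρ _ N N ?_ v).symm
  rw [expNil_inv, coe_expNil]
  change N.1 = (1 + s • N.1) * N.1 * (1 + -s • N.1)
  simp [add_mul, mul_add, hN]

/-- By the group law the hypothesis says that the polynomial `t ↦ φ(ρ(1 + tN)v)` has zero derivative
at every `s`; in characteristic zero it is constant. Since `h` concerns the pair `(φ, v)`, this
serves both fixed vectors and fixed functionals. -/
theorem eval_eq_of_apply_eq_zero (hd : IsLinearDifferential ρ d)
    (hρ : ∀ (φ : Module.Dual K V) (v : V), (fun g => φ (ρ g v)) ∈ regSL3 K)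
    {N : sl3 K} (hN : N.1 * N.1 = 0) {φ : Module.Dual K V} {v : V}
    (h : ∀ s, φ (d N (ρ (expNil hN s) v)) = 0) (t : K) : φ (ρ (expNil hN t) v) = φ v := by
  obtain ⟨q, hq⟩ := exists_polynomial_matrixCoeff hρ hN φ v
  have hder : q.derivative = 0 := by
    refine Polynomial.funext fun s => ?_
    have := hd.apply_of_sq_eq_zero hρ hN (φ := φ ∘ₗ ρ (expNil hN s)) (v := v)
      (q := q.comp (Polynomial.X + Polynomial.C s)) fun t => by
        rw [LinearMap.comp_apply, ← Module.End.mul_apply, ← map_mul, ← expNil_add, hq, add_comm]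
        simp
    rw [LinearMap.comp_apply, ← hd.apply_expNil hρ, h s, Polynomial.derivative_comp] at this
    simpa using this.symm
  rw [Polynomial.eq_C_of_derivative_eq_zero hder] at hq
  have h0 := hq 0
  rw [hq t, Polynomial.eval_C]
  simpa using h0.symm

theorem apply_eq_zero_of_fixed (hd : IsLinearDifferential ρ d)
    (hρ : ∀ (φ : Module.Dual K V) (v : V), (fun g => φ (ρ g v)) ∈ regSL3 K)
    {N : sl3 K} (hN : N.1 * N.1 = 0) {v : V} (h : ∀ t, ρ (expNil hN t) v = v) : d N v = 0 := by
  refine (Module.forall_dual_apply_eq_zero_iff K _).1 fun φ => ?_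
  rw [hd.apply_of_sq_eq_zero hρ hN (q := Polynomial.C (φ v)) fun t => by rw [h t]; simp]
  simp

/-- The vectors killed by `N` are those fixed by `1 + tN`. -/
theorem apply_eq_zero_iff (hd : IsLinearDifferential ρ d)
    (hρ : ∀ (φ : Module.Dual K V) (v : V), (fun g => φ (ρ g v)) ∈ regSL3 K)
    {N : sl3 K} (hN : N.1 * N.1 = 0) {v : V} : d N v = 0 ↔ ∀ t, ρ (expNil hN t) v = v := by
  refine ⟨fun h t => ?_, hd.apply_eq_zero_of_fixed hρ hN⟩
  refine sub_eq_zero.1 ((Module.forall_dual_apply_eq_zero_iff K _).1 fun φ => ?_)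
  rw [map_sub, hd.eval_eq_of_apply_eq_zero hρ hN
    (fun s => by rw [hd.apply_expNil hρ, h, map_zero, map_zero]), sub_self]

/-- A subspace stable under the group elements `1 + tN` is stable under `N`. -/
theorem apply_mem (hd : IsLinearDifferential ρ d)
    (hρ : ∀ (φ : Module.Dual K V) (v : V), (fun g => φ (ρ g v)) ∈ regSL3 K)
    {N : sl3 K} (hN : N.1 * N.1 = 0) {S : Submodule K V} {v : V}
    (h : ∀ t, ρ (expNil hN t) v ∈ S) : d N v ∈ S := by
  rw [← Subspace.forall_mem_dualAnnihilator_apply_eq_zero_iff]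
  intro φ hφ
  rw [hd.apply_of_sq_eq_zero hρ hN (q := 0) fun t => by
    simpa using (Submodule.mem_dualAnnihilator φ).1 hφ _ (h t)]
  simp

end IsLinearDifferential

theorem exists_isDifferential [FiniteDimensional K V]
    (hρ : ∀ (φ : Module.Dual K V) (v : V), (fun g => φ (ρ g v)) ∈ regSL3 K) :
    ∃ D : sl3 K →ₗ⁅K⁆ Module.End K V, IsDifferential ρ D := by
  obtain ⟨d, hd⟩ := exists_isLinearDifferential hρ
  exact ⟨{ d with map_lie' := fun {X Y} => hd.map_lie hρ X Y }, hd⟩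

end Differential

/-! ### Finite-dimensional `sl₂`-theory: decomposition into strings. -/

section SlTwo

variable {K : Type*} [Field K] {V : Type*} [AddCommGroup V] [Module K V]

/-- Operators that raise the eigenvalues of `H` by positive integers have a common null vector that
is an eigenvector of `H`. -/
theorem exists_eigenvector_of_raising [CharZero K] [IsAlgClosed K] [FiniteDimensional K V] [Nontrivial V]
    {ι : Type*} (H : Module.End K V) (E : ι → Module.End K V) (c : ι → ℕ) (hc : ∀ i, c i ≠ 0)
    (hE : ∀ i, H * E i - E i * H = (c i : K) • E i) :
    ∃ (v : V) (μ : K), v ≠ 0 ∧ H v = μ • v ∧ ∀ i, E i v = 0 := by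
  obtain ⟨μ₀, hμ₀⟩ := Module.End.exists_eigenvalue H
  have hfin : {n : ℕ | H.HasEigenvalue (μ₀ + n)}.Finite :=
    (Module.End.finite_hasEigenvalue H).preimage
      (Function.Injective.injOn fun m n h => by simpa using h)
  -- Take `n` maximal with `μ₀ + n` an eigenvalue; a nonzero `E i v` would have the larger
  -- eigenvalue `μ₀ + n + c i`.
  obtain ⟨n, hn, hmax⟩ := Set.exists_max_image _ id hfin ⟨0, by simpa using hμ₀⟩
  obtain ⟨v, hv⟩ := Module.End.HasEigenvalue.exists_hasEigenvector hn
  refine ⟨v, μ₀ + n, hv.2, hv.apply_eq_smul, fun i => ?_⟩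
  by_contra hne
  have h1 : H (E i v) = (μ₀ + (n + c i : ℕ)) • E i v := by
    have := LinearMap.congr_fun (hE i) v
    simp only [LinearMap.sub_apply, Module.End.mul_apply, LinearMap.smul_apply, hv.apply_eq_smul,
      map_smul] at this
    rw [sub_eq_iff_eq_add.1 this, ← add_smul]
    push_cast
    congr 1
    ring
  have h2 := hmax (n + c i)
    (Module.End.hasEigenvalue_of_hasEigenvector ⟨Module.End.mem_eigenspace_iff.2 h1, hne⟩)
  have := hc i
  simp only [id] at h2
  omega

/-- The commutation relations of the standard basis of `sl₂`. -/
structure SlTwoRel (E H F : Module.End K V) : Prop where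
  ef : E * F - F * E = H
  he : H * E - E * H = (2 : K) • E
  hf : H * F - F * H = -(2 : K) • F

namespace SlTwoRel

variable {E H F : Module.End K V}

theorem ef_apply (r : SlTwoRel E H F) (v : V) : E (F v) = F (E v) + H v := by
  have := LinearMap.congr_fun r.ef v
  exact sub_eq_iff_eq_add'.1 this

theorem he_apply (r : SlTwoRel E H F) (v : V) : H (E v) = E (H v) + (2 : K) • E v := by
  have := LinearMap.congr_fun r.he v
  exact sub_eq_iff_eq_add'.1 this

theorem hf_apply (r : SlTwoRel E H F) (v : V) : H (F v) = F (H v) - (2 : K) • F v := by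
  have := LinearMap.congr_fun r.hf v
  rw [sub_eq_add_neg, ← neg_smul]
  exact sub_eq_iff_eq_add'.1 this

section Primitive

variable {v : V} {μ : K}

theorem h_pow (r : SlTwoRel E H F) (hH : H v = μ • v) (k : ℕ) : H ((F ^ k) v) = (μ - 2 * k) • (F ^ k) v := by
  induction k with
  | zero => simpa using hH
  | succ k ih =>
    rw [pow_succ', Module.End.mul_apply, r.hf_apply, ih, map_smul, ← sub_smul]
    push_cast
    congr 1
    ring

theorem e_pow_succ (r : SlTwoRel E H F) (hH : H v = μ • v) (hE : E v = 0) (k : ℕ) :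
    E ((F ^ (k + 1)) v) = ((k + 1) * (μ - k)) • (F ^ k) v := by
  induction k with
  | zero => simp [r.ef_apply, hE, hH]
  | succ k ih =>
    rw [pow_succ', Module.End.mul_apply, r.ef_apply, ih, r.h_pow hH, map_smul,
      ← Module.End.mul_apply, ← pow_succ', ← add_smul]
    push_cast
    congr 1
    ring

variable [CharZero K]

/-- The nonzero `F^k v` have distinct `H`-eigenvalues, so there is a first `m` with `F^(m+1) v = 0`.
Applying `E` gives `(m+1)(μ - m) = 0`. -/
theorem exists_nat (r : SlTwoRel E H F) (hH : H v = μ • v) [FiniteDimensional K V] (hE : E v = 0) (hv : v ≠ 0) : ∃ n : ℕ, μ = n := by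
  classical
  have hex : ∃ k, (F ^ k) v = 0 := by
    by_contra! h
    have hinf : Set.Infinite (Set.range fun k : ℕ => μ - 2 * (k : K)) :=
      Set.infinite_range_of_injective fun m n h => by simpa using h
    refine hinf ((Module.End.finite_hasEigenvalue H).subset ?_)
    rintro _ ⟨k, rfl⟩
    exact Module.End.hasEigenvalue_of_hasEigenvector
      ⟨Module.End.mem_eigenspace_iff.2 (r.h_pow hH k), h k⟩
  obtain ⟨m, hm⟩ : ∃ m, Nat.find hex = m + 1 := Nat.exists_eq_succ_of_ne_zero fun h0 => by
    have := Nat.find_spec hex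
    rw [h0] at this
    exact hv (by simpa using this)
  have h1 := r.e_pow_succ hH hE m
  rw [← hm, Nat.find_spec hex, map_zero] at h1
  have h2 : (F ^ m) v ≠ 0 := Nat.find_min hex (by omega)
  have h3 := (smul_eq_zero.1 h1.symm).resolve_right h2
  refine ⟨m, sub_eq_zero.1 ((mul_eq_zero.1 h3).resolve_left ?_)⟩
  exact_mod_cast Nat.succ_ne_zero m

end Primitive

section PrimitiveNat

variable [CharZero K]

variable {v : V} {n : ℕ}

/-- Otherwise `F^(n+1) v` would be a primitive vector of weight `-n-2`, which is not a natural
number. -/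
theorem pow_succ_eq_zero (r : SlTwoRel E H F) (hH : H v = (n : K) • v)
    (hE : E v = 0) [FiniteDimensional K V] : (F ^ (n + 1)) v = 0 := by
  by_contra hne
  obtain ⟨m, hm⟩ := r.exists_nat (r.h_pow hH (n + 1))
    (by rw [r.e_pow_succ hH hE, sub_self, mul_zero, zero_smul]) hne
  have : ((m + n + 2 : ℕ) : K) = 0 := by
    push_cast at hm ⊢
    linear_combination -hm
  exact absurd (Nat.cast_eq_zero.1 this) (by omega)

theorem exists_e_pow_f_pow (r : SlTwoRel E H F) (hH : H v = (n : K) • v)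
    (hE : E v = 0) (m : ℕ) :
    ∃ γ : K, (m ≤ n → γ ≠ 0) ∧ (E ^ m) ((F ^ m) v) = γ • v := by
  induction m with
  | zero => exact ⟨1, by simp, by simp⟩
  | succ m ih =>
    obtain ⟨γ, h0, h⟩ := ih
    refine ⟨(m + 1) * (n - m) * γ, fun hm => ?_, ?_⟩
    · refine mul_ne_zero (mul_ne_zero (by exact_mod_cast Nat.succ_ne_zero m) ?_) (h0 (by omega))
      rw [← Nat.cast_sub (by omega)]
      exact_mod_cast (by omega : n - m ≠ 0)
    · rw [pow_succ E, Module.End.mul_apply, r.e_pow_succ hH hE, map_smul, h, smul_smul]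

theorem e_pow_f_pow_eq_zero (r : SlTwoRel E H F) (hH : H v = (n : K) • v)
    (hE : E v = 0) {k m : ℕ} (h : k < m) : (E ^ m) ((F ^ k) v) = 0 := by
  obtain ⟨j, rfl⟩ := Nat.exists_eq_add_of_lt h
  obtain ⟨γ, -, hγ⟩ := r.exists_e_pow_f_pow hH hE k
  rw [show k + j + 1 = j + (1 + k) by ring, pow_add, pow_add, Module.End.mul_apply,
    Module.End.mul_apply, hγ]
  simp [hE]

end PrimitiveNat

section Decomposition

variable {ι : Type*} {w : ι → V} {n : ι → ℕ}

/-- The vectors `F ^ k wᵢ`, `0 ≤ k ≤ nᵢ`. -/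
def strings (F : Module.End K V) (w : ι → V) (n : ι → ℕ) (x : Σ i, Fin (n i + 1)) : V :=
  (F ^ (x.2 : ℕ)) (w x.1)

/-- If `m` bounds the positions that occur in a relation, `E^m` kills the terms below position `m`
and sends `F^m wᵢ` to a nonzero multiple of `wᵢ`. Independence of `w` removes position `m`, and one
descends. -/
theorem linearIndependent_strings [CharZero K] (r : SlTwoRel E H F) [Finite ι] (hw : LinearIndependent K w)
    (hE : ∀ i, E (w i) = 0) (hH : ∀ i, H (w i) = (n i : K) • w i) :
    LinearIndependent K (strings F w n) := by
  cases nonempty_fintype ι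
  have key : ∀ (m : ℕ) (c : (Σ i, Fin (n i + 1)) → K), (∀ x, m ≤ (x.2 : ℕ) → c x = 0) →
      ∑ x, c x • strings F w n x = 0 → ∀ x, c x = 0 := by
    intro m
    induction m with
    | zero => exact fun c hc _ x => hc x (Nat.zero_le _)
    | succ m ih =>
      intro c hc hsum
      refine ih c (fun x hx => ?_) hsum
      rcases Nat.lt_or_ge m x.2 with hlt | hle
      · exact hc x hlt
      choose γ hγ0 hγ using fun i => r.exists_e_pow_f_pow (hH i) (hE i) m
      let c' : ι → K := fun i => if h : m < n i + 1 then c ⟨i, ⟨m, h⟩⟩ * γ i else 0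
      have h1 : ∑ i, c' i • w i = 0 := by
        have := congrArg (E ^ m) hsum
        rw [map_zero, map_sum, Fintype.sum_sigma] at this
        rw [← this]
        refine Finset.sum_congr rfl fun i _ => ?_
        by_cases h : m < n i + 1
        · rw [Finset.sum_eq_single ⟨m, h⟩]
          · simp only [c', h, dif_pos, map_smul, strings, hγ, smul_smul]
          · intro k _ hk
            have hk' : (k : ℕ) ≠ m := fun h' => hk (Fin.ext h')
            rcases Nat.lt_or_ge k m with h'' | h''
            · rw [map_smul, strings, r.e_pow_f_pow_eq_zero (hH i) (hE i) h'', smul_zero]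
            · rw [hc _ (by simp only; omega), zero_smul, map_zero]
          · simp
        · simp only [c', h, dif_neg, not_false_eq_true, zero_smul]
          refine (Finset.sum_eq_zero fun k _ => ?_).symm
          rw [map_smul, strings, r.e_pow_f_pow_eq_zero (hH i) (hE i) (by simp only; omega),
            smul_zero]
      have h2 := Fintype.linearIndependent_iff.1 hw c' h1 x.1
      obtain ⟨i, k⟩ := x
      have hk : (k : ℕ) = m := le_antisymm hle hx
      have hm : m < n i + 1 := hk ▸ k.2
      simp only [c', hm, dif_pos] at h2
      have := (mul_eq_zero.1 h2).resolve_right (hγ0 i (by omega))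
      rwa [show (⟨m, hm⟩ : Fin (n i + 1)) = k from Fin.ext hk.symm] at this
  refine Fintype.linearIndependent_iff.2 fun c hsum => ?_
  -- The sum exceeds every position in every string, so the vanishing condition on `c` is vacuous.
  refine key (∑ i, (n i + 1)) c (fun x hx => absurd x.2.2 ?_) hsum
  have : n x.1 + 1 ≤ ∑ i, (n i + 1) :=
    Finset.single_le_sum (f := fun i => n i + 1) (fun _ _ => Nat.zero_le _) (Finset.mem_univ x.1)
  omega

theorem f_strings [CharZero K] (r : SlTwoRel E H F) [FiniteDimensional K V] (hE : ∀ i, E (w i) = 0)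
    (hH : ∀ i, H (w i) = (n i : K) • w i) (x : Σ i, Fin (n i + 1)) :
    F (strings F w n x) = 0 ∨ ∃ y : Σ i, Fin (n i + 1), y.1 = x.1 ∧
      F (strings F w n x) = strings F w n y := by
  obtain ⟨i, k⟩ := x
  by_cases h : (k : ℕ) + 1 < n i + 1
  · exact .inr ⟨⟨i, ⟨k + 1, h⟩⟩, rfl, by simp [strings, pow_succ']⟩
  · left
    have hk : (k : ℕ) + 1 = n i + 1 := by omega
    rw [strings, ← Module.End.mul_apply, ← pow_succ', hk, r.pow_succ_eq_zero (hH i) (hE i)]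

/-- The strict bound on `y.2` records that `E` never produces the last vector of a string;
`span_strings` depends on this. -/
theorem e_strings (r : SlTwoRel E H F) (hE : ∀ i, E (w i) = 0)
    (hH : ∀ i, H (w i) = (n i : K) • w i) (x : Σ i, Fin (n i + 1)) :
    E (strings F w n x) = 0 ∨ ∃ (y : Σ i, Fin (n i + 1)) (c : K), y.1 = x.1 ∧
      (y.2 : ℕ) < n y.1 ∧ E (strings F w n x) = c • strings F w n y := by
  obtain ⟨i, ⟨k, hk⟩⟩ := x
  cases k with
  | zero => exact .inl (by simpa [strings] using hE i)
  | succ k =>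
    exact .inr ⟨⟨i, ⟨k, by omega⟩⟩, _, rfl, by simp only; omega, r.e_pow_succ (hH i) (hE i) k⟩

theorem h_strings (r : SlTwoRel E H F) (hH : ∀ i, H (w i) = (n i : K) • w i) (x : Σ i, Fin (n i + 1)) :
    H (strings F w n x) = ((n x.1 : K) - 2 * ((x.2 : ℕ) : K)) • strings F w n x :=
  r.h_pow (hH x.1) x.2

/-- Vectors that are not at the end of a string are in the image of `E`. -/
theorem exists_e_eq_strings [CharZero K] (r : SlTwoRel E H F) (hE : ∀ i, E (w i) = 0)
    (hH : ∀ i, H (w i) = (n i : K) • w i) (x : Σ i, Fin (n i + 1)) (hx : (x.2 : ℕ) < n x.1) :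
    ∃ (y : Σ i, Fin (n i + 1)) (c : K), E (c • strings F w n y) = strings F w n x := by
  obtain ⟨i, ⟨k, hk⟩⟩ := x
  refine ⟨⟨i, ⟨k + 1, by simp only at hx; omega⟩⟩, (((k : K) + 1) * (n i - k))⁻¹, ?_⟩
  rw [map_smul, strings, r.e_pow_succ (hH i) (hE i), smul_smul, inv_mul_cancel₀, one_smul]
  · rfl
  · refine mul_ne_zero (by exact_mod_cast Nat.succ_ne_zero k) ?_
    simp only at hx
    rw [← Nat.cast_sub hx.le]
    exact_mod_cast (by omega : n i - k ≠ 0)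

end Decomposition

end SlTwoRel

end SlTwo

namespace SlTwoRel

variable {K : Type*} [Field K] {V : Type*} [AddCommGroup V] [Module K V]
  {E H F : Module.End K V} {ι : Type*} {w : ι → V} {n : ι → ℕ}

/-- The span of the string through `wᵢ`. -/
def stringSpan (F : Module.End K V) (w : ι → V) (n : ι → ℕ) (i : ι) : Submodule K V :=
  Submodule.span K (strings F w n '' {x | x.1 = i})

theorem strings_mem_stringSpan (x : Σ i, Fin (n i + 1)) :
    strings F w n x ∈ stringSpan F w n x.1 :=
  Submodule.subset_span ⟨x, rfl, rfl⟩

theorem mem_stringSpan (i : ι) : w i ∈ stringSpan F w n i := by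
  simpa [strings] using strings_mem_stringSpan (F := F) (w := w) (n := n) ⟨i, 0⟩

theorem iSup_stringSpan :
    ⨆ i, stringSpan F w n i = Submodule.span K (Set.range (strings F w n)) := by
  refine le_antisymm (iSup_le fun i => Submodule.span_mono (Set.image_subset_range _ _))
    (Submodule.span_le.2 ?_)
  rintro _ ⟨x, rfl⟩
  exact Submodule.mem_iSup_of_mem x.1 (strings_mem_stringSpan x)

theorem stringSpan_induction {i : ι} {S : Submodule K V} {G : Module.End K V}
    (h : ∀ x : Σ i, Fin (n i + 1), x.1 = i → G (strings F w n x) ∈ S) {v : V}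
    (hv : v ∈ stringSpan F w n i) : G v ∈ S := by
  have : stringSpan F w n i ≤ S.comap G := Submodule.span_le.2 (by
    rintro _ ⟨x, hx, rfl⟩
    exact h x hx)
  exact this hv

theorem f_mem_stringSpan [CharZero K] (r : SlTwoRel E H F) [FiniteDimensional K V] (hE : ∀ i, E (w i) = 0)
    (hH : ∀ i, H (w i) = (n i : K) • w i) {i : ι} {v : V} (hv : v ∈ stringSpan F w n i) :
    F v ∈ stringSpan F w n i := by
  refine stringSpan_induction (fun x hx => ?_) hv
  obtain h | ⟨y, hy, h⟩ := r.f_strings hE hH x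
  · rw [h]
    exact zero_mem _
  · rw [h, ← hx, ← hy]
    exact strings_mem_stringSpan y

theorem e_mem_stringSpan (r : SlTwoRel E H F) (hE : ∀ i, E (w i) = 0)
    (hH : ∀ i, H (w i) = (n i : K) • w i) {i : ι} {v : V} (hv : v ∈ stringSpan F w n i) :
    E v ∈ stringSpan F w n i := by
  refine stringSpan_induction (fun x hx => ?_) hv
  obtain h | ⟨y, c, hy, -, h⟩ := r.e_strings hE hH x
  · rw [h]
    exact zero_mem _
  · rw [h, ← hx, ← hy]
    exact Submodule.smul_mem _ _ (strings_mem_stringSpan y)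

theorem iSupIndep_stringSpan (h : LinearIndependent K (strings F w n)) :
    iSupIndep (stringSpan F w n) := by
  intro i
  have : ⨆ j, ⨆ (_ : j ≠ i), stringSpan F w n j
      ≤ Submodule.span K (strings F w n '' {x | x.1 ≠ i}) :=
    iSup₂_le fun j hj => Submodule.span_mono (Set.image_mono fun x hx => by
      simp only [Set.mem_ofPred_eq] at hx ⊢
      rwa [hx])
  refine Disjoint.mono_right this (h.disjoint_span_image ?_)
  exact Set.disjoint_left.2 fun x hx hx' => hx' hx

theorem finrank_stringSpan (h : LinearIndependent K (strings F w n)) (i : ι) :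
    Module.finrank K (stringSpan F w n i) = n i + 1 := by
  have hli : LinearIndependent K fun k : Fin (n i + 1) => strings F w n ⟨i, k⟩ :=
    h.comp (fun k : Fin (n i + 1) => (⟨i, k⟩ : Σ i, Fin (n i + 1))) (sigma_mk_injective (β := fun i => Fin (n i + 1)))
  have himage : strings F w n '' {x | x.1 = i} = Set.range fun k => strings F w n ⟨i, k⟩ := by
    ext v
    constructor
    · rintro ⟨⟨j, k⟩, rfl, rfl⟩
      exact ⟨k, rfl⟩
    · rintro ⟨k, rfl⟩
      exact ⟨⟨i, k⟩, rfl, rfl⟩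
  rw [stringSpan, himage, finrank_span_eq_card hli, Fintype.card_fin]

/-- A linear left inverse of the linear combination map of a linearly independent family. -/
theorem exists_coordinates {X : Type*} {b : X → V} (h : LinearIndependent K b) :
    ∃ g : V →ₗ[K] (X →₀ K), ∀ c, g (Finsupp.linearCombination K b c) = c := by
  obtain ⟨g, hg⟩ := LinearMap.exists_leftInverse_of_injective (Finsupp.linearCombination K b)
    (LinearMap.ker_eq_bot.2 h)
  exact ⟨g, fun c => LinearMap.congr_fun hg c⟩

/-- The strings are simple. -/
theorem eq_bot_or_eq_stringSpan [CharZero K] [IsAlgClosed K] [FiniteDimensional K V] (r : SlTwoRel E H F)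
    (hli : LinearIndependent K (strings F w n))
    (hker : ∀ v, E v = 0 → v ∈ Submodule.span K (Set.range w)) {i : ι} {S : Submodule K V}
    (hS : S ≤ stringSpan F w n i) (hSE : ∀ v ∈ S, E v ∈ S) (hSF : ∀ v ∈ S, F v ∈ S) :
    S = ⊥ ∨ S = stringSpan F w n i := by
  refine or_iff_not_imp_left.2 fun hbot => le_antisymm hS ?_
  have hSH : ∀ v ∈ S, H v ∈ S := fun v hv => by
    have := r.ef_apply v
    rw [show H v = E (F v) - F (E v) from eq_sub_of_add_eq' this.symm]
    exact S.sub_mem (hSE _ (hSF _ hv)) (hSF _ (hSE _ hv))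
  have : Nontrivial S := Submodule.nontrivial_iff_ne_bot.2 hbot
  -- A nonzero `S` contains a nonzero vector killed by `E`. It lies both in the span of `w` and in
  -- the `i`-th string, hence is a multiple of `wᵢ`, and powers of `F` then give the whole string.
  obtain ⟨v, μ, hv0, -, hv⟩ := exists_eigenvector_of_raising (ι := Unit) (H.restrict hSH)
    (fun _ => E.restrict hSE) (fun _ => 2) (by simp) fun _ => by
      ext u
      simpa [sub_eq_iff_eq_add'] using r.he_apply (u : V)
  have hEv : E (v : V) = 0 := congrArg Subtype.val (hv ())
  obtain ⟨g, hg⟩ := exists_coordinates hli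
  have hgs (x) : g (strings F w n x) = Finsupp.single x 1 := by
    simpa using hg (Finsupp.single x 1)
  have hws (j : ι) : w j = strings F w n ⟨j, 0⟩ := by simp [strings]
  have h1 (u : V) (hu : u ∈ stringSpan F w n i) (x : Σ i, Fin (n i + 1)) (hx : x.1 ≠ i) :
      g u x = 0 := by
    induction hu using Submodule.span_induction with
    | mem u hu =>
      obtain ⟨y, hy, rfl⟩ := hu
      rw [hgs, Finsupp.single_eq_of_ne]
      rintro rfl
      exact hx hy
    | zero => simp
    | add u u' _ _ h h' => simp [h, h']
    | smul c u _ h => simp [h]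
  have h2 (u : V) (hu : u ∈ Submodule.span K (Set.range w)) :
      Finsupp.linearCombination K (strings F w n) (g u) = u ∧
        ∀ x : Σ i, Fin (n i + 1), (x.2 : ℕ) ≠ 0 → g u x = 0 := by
    induction hu using Submodule.span_induction with
    | mem u hu =>
      obtain ⟨j, rfl⟩ := hu
      rw [hws, hgs]
      refine ⟨by simp, fun x hx => ?_⟩
      rw [Finsupp.single_eq_of_ne]
      rintro rfl
      simp at hx
    | zero => simp
    | add u u' _ _ h h' =>
      refine ⟨by rw [map_add, map_add, h.1, h'.1], fun x hx => ?_⟩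
      simp [h.2 x hx, h'.2 x hx]
    | smul c u _ h =>
      refine ⟨by rw [map_smul, map_smul, h.1], fun x hx => ?_⟩
      simp [h.2 x hx]
  obtain ⟨h3, h4⟩ := h2 v (hker v hEv)
  have h5 : g (v : V) = Finsupp.single ⟨i, 0⟩ (g (v : V) ⟨i, 0⟩) := by
    ext x
    obtain ⟨j, k⟩ := x
    by_cases hj : j = i
    · subst hj
      by_cases hk : k = 0
      · subst hk
        simp
      · rw [h4 _ (by simpa using Fin.val_ne_of_ne hk), Finsupp.single_eq_of_ne]
        intro h
        simp at h
        exact hk h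
    · rw [h1 v (hS v.2) _ hj, Finsupp.single_eq_of_ne]
      intro h
      exact hj (congrArg Sigma.fst h)
  have hw : w i ∈ S := by
    rw [h5, Finsupp.linearCombination_single, ← hws] at h3
    have hne : g (v : V) ⟨i, 0⟩ ≠ 0 := by
      intro h0
      rw [h0, zero_smul] at h3
      exact hv0 (Subtype.ext h3.symm)
    have : w i = (g (v : V) ⟨i, 0⟩)⁻¹ • (v : V) := by
      rw [eq_inv_smul_iff₀ hne, h3]
    rw [this]
    exact S.smul_mem _ v.2
  refine Submodule.span_le.2 ?_
  rintro _ ⟨⟨j, k⟩, rfl, rfl⟩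
  change (F ^ (k : ℕ)) (w j) ∈ S
  generalize (k : ℕ) = m
  induction m with
  | zero => simpa using hw
  | succ m ih =>
    rw [pow_succ', Module.End.mul_apply]
    exact hSF _ ih

/-- The strings span the whole space. -/
theorem span_strings [CharZero K] [IsAlgClosed K] [FiniteDimensional K V] (r : SlTwoRel E H F)
    (hli : LinearIndependent K (strings F w n)) (hE : ∀ i, E (w i) = 0)
    (hH : ∀ i, H (w i) = (n i : K) • w i)
    (hker : ∀ v, E v = 0 → v ∈ Submodule.span K (Set.range w)) :
    Submodule.span K (Set.range (strings F w n)) = ⊤ := by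
  set S := Submodule.span K (Set.range (strings F w n)) with hSdef
  have hmem (x) : strings F w n x ∈ S := Submodule.subset_span ⟨x, rfl⟩
  have hle (i : ι) : stringSpan F w n i ≤ S := Submodule.span_mono (Set.image_subset_range _ _)
  have hSE : S ≤ S.comap E := Submodule.span_le.2 (by
    rintro _ ⟨x, rfl⟩
    exact hle x.1 (r.e_mem_stringSpan hE hH (strings_mem_stringSpan x)))
  have hSF : S ≤ S.comap F := Submodule.span_le.2 (by
    rintro _ ⟨x, rfl⟩
    exact hle x.1 (r.f_mem_stringSpan hE hH (strings_mem_stringSpan x)))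
  have hSH : S ≤ S.comap H := Submodule.span_le.2 (by
    rintro _ ⟨x, rfl⟩
    change H _ ∈ S
    rw [r.h_strings hH]
    exact S.smul_mem _ (hmem x))
  -- If `V/S ≠ 0`, lift a primitive vector of the quotient to `q`, so that `Eq ∈ S`. Once `Eq = Es`
  -- with `s ∈ S`, the difference `q - s` is in `ker E ⊆ S`, a contradiction.
  by_contra hne
  have : Nontrivial (V ⧸ S) := Submodule.Quotient.nontrivial_iff.2 hne
  have rq : SlTwoRel (S.mapQ S E hSE) (S.mapQ S H hSH) (S.mapQ S F hSF) := by
    constructor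
    · ext v
      simpa [sub_eq_iff_eq_add'] using congrArg S.mkQ (r.ef_apply v)
    · ext v
      simpa [sub_eq_iff_eq_add'] using congrArg S.mkQ (r.he_apply v)
    · ext v
      have := congrArg S.mkQ (r.hf_apply v)
      rw [map_sub] at this
      simpa [sub_eq_iff_eq_add', ← sub_eq_add_neg] using this
  obtain ⟨qbar, μ, hq0, hqH, hqE⟩ := exists_eigenvector_of_raising (ι := Unit) (S.mapQ S H hSH)
    (fun _ => S.mapQ S E hSE) (fun _ => 2) (by simp) fun _ => by simpa using rq.he
  obtain ⟨N, rfl⟩ := rq.exists_nat hqH (hqE ()) hq0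
  obtain ⟨q, rfl⟩ := S.mkQ_surjective qbar
  have hqS : q ∉ S := fun h => hq0 ((Submodule.Quotient.mk_eq_zero S).2 h)
  have hEq : E q ∈ S := (Submodule.Quotient.mk_eq_zero S).1 (hqE ())
  have hHq : H q - (N : K) • q ∈ S := (Submodule.Quotient.eq S).1 hqH
  obtain ⟨g, hg⟩ := exists_coordinates hli
  have hgs (x) : g (strings F w n x) = Finsupp.single x 1 := by
    simpa using hg (Finsupp.single x 1)
  have hgS (u : V) (hu : u ∈ S) : Finsupp.linearCombination K (strings F w n) (g u) = u := by
    obtain ⟨c, rfl⟩ := (Finsupp.mem_span_range_iff_exists_finsupp).1 hu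
    exact congrArg _ (hg c)
  have hgE (u : V) (hu : u ∈ S) (x : Σ i, Fin (n i + 1)) (hx : (x.2 : ℕ) = n x.1) :
      g (E u) x = 0 := by
    induction hu using Submodule.span_induction with
    | mem u hu =>
      obtain ⟨y, rfl⟩ := hu
      obtain h | ⟨z, c, -, hz, h⟩ := r.e_strings hE hH y
      · simp [h]
      · rw [h, map_smul, hgs, Finsupp.smul_apply, Finsupp.single_eq_of_ne, smul_zero]
        rintro rfl
        omega
    | zero => simp
    | add u u' _ _ h h' => simp [h, h']
    | smul c u _ h => simp [h]
  have hgH (u : V) (hu : u ∈ S) (x : Σ i, Fin (n i + 1)) :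
      g (H u) x = ((n x.1 : K) - 2 * ((x.2 : ℕ) : K)) * g u x := by
    induction hu using Submodule.span_induction with
    | mem u hu =>
      obtain ⟨y, rfl⟩ := hu
      rw [r.h_strings hH, map_smul, hgs, Finsupp.smul_apply, smul_eq_mul]
      by_cases h : y = x
      · subst h
        rfl
      · rw [Finsupp.single_eq_of_ne (Ne.symm h), mul_zero, mul_zero]
    | zero => simp
    | add u u' _ _ h h' => simp [h, h', mul_add]
    | smul c u _ h => simp [h, mul_left_comm]
  -- At the end of the string of `wᵢ` the operator `H` has eigenvalue `-nᵢ`, while `H(Eq)` is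
  -- `(N+2)Eq` plus an element of `E(S)`, which has no such coordinate. So `(N + 2 + nᵢ)` times the
  -- coordinate is zero.
  have htop (x : Σ i, Fin (n i + 1)) (hx : (x.2 : ℕ) = n x.1) : g (E q) x = 0 := by
    have h1 : H (E q) = ((N : K) + 2) • E q + E (H q - (N : K) • q) := by
      rw [r.he_apply, map_sub, map_smul, add_smul]
      abel
    have h2 := hgH _ hEq x
    rw [h1, map_add, map_smul, Finsupp.add_apply, hgE _ hHq x hx, hx, Finsupp.smul_apply,
      smul_eq_mul] at h2
    have h3 : ((N + 2 + n x.1 : ℕ) : K) * g (E q) x = 0 := by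
      push_cast
      linear_combination h2
    exact (mul_eq_zero.1 h3).resolve_left (Nat.cast_ne_zero.2 (by omega))
  have himage : E q ∈ S.map E := by
    rw [← hgS _ hEq]
    refine Submodule.sum_mem _ fun x _ => ?_
    change g (E q) x • strings F w n x ∈ S.map E
    by_cases hx : (x.2 : ℕ) = n x.1
    · rw [htop x hx, zero_smul]
      exact zero_mem _
    · obtain ⟨y, c, hy⟩ := r.exists_e_eq_strings hE hH x (by omega)
      rw [← hy]
      exact Submodule.smul_mem _ _ ⟨_, S.smul_mem c (hmem y), rfl⟩
  obtain ⟨s, hs, hsq⟩ := himage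
  have hdiff : q - s ∈ S := by
    have h := hker (q - s) (by rw [map_sub, hsq, sub_self])
    refine Submodule.span_le.2 ?_ h
    rintro _ ⟨i, rfl⟩
    exact hle i (mem_stringSpan i)
  exact hqS (by simpa using S.add_mem hdiff hs)

end SlTwoRel

/-! ### Root vectors, `U`-fixed functionals and the torus. -/

section HighestWeight

variable {K : Type*} [Field K]

/-- The root vectors `E_ij` of `sl₃`. -/
abbrev rootVector (K : Type*) [Field K] {i j : Fin 3} (h : i ≠ j) : sl3 K :=
  LieAlgebra.SpecialLinear.single i j h 1

theorem rootVector_sq {i j : Fin 3} (h : i ≠ j) :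
    (rootVector K h).1 * (rootVector K h).1 = 0 :=
  single_mul_single_self h

theorem lie_eθ_fθ : ⁅eθ K, fθ K⁆ = halfH K := by
  apply Subtype.ext
  rw [LieAlgebra.SpecialLinear.sl_bracket]
  simp [eθ, fθ, halfH]

/-- The diagonal entries of `h/2` are `1 - i` for `i = 0, 1, 2`, so `h/2` grades the root vectors by
height. -/
theorem lie_halfH_rootVector {i j : Fin 3} (h : i ≠ j) :
    ⁅halfH K, rootVector K h⁆ = ((j : ℕ) - (i : ℕ) : K) • rootVector K h := by
  apply Subtype.ext
  rw [LieAlgebra.SpecialLinear.sl_bracket]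
  fin_cases i <;> fin_cases j <;> simp [halfH, sub_mul, mul_sub] at h ⊢ <;> ext i j <;>
    fin_cases i <;> fin_cases j <;> simp <;> norm_num

variable {V : Type*} [AddCommGroup V] [Module K V]

theorem slTwoRel (D : sl3 K →ₗ⁅K⁆ Module.End K V) :
    SlTwoRel (D (eθ K)) (D (halfH K)) (D (fθ K)) where
  ef := by rw [← LieRing.of_associative_ring_bracket, ← LieHom.map_lie, lie_eθ_fθ]
  he := by
    rw [← LieRing.of_associative_ring_bracket, ← LieHom.map_lie, eθ, lie_halfH_rootVector]
    simp
  hf := by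
    rw [← LieRing.of_associative_ring_bracket, ← LieHom.map_lie, fθ, lie_halfH_rootVector]
    simp

theorem h01 : (0 : Fin 3) ≠ 1 := by decide
theorem h02 : (0 : Fin 3) ≠ 2 := by decide
theorem h12 : (1 : Fin 3) ≠ 2 := by decide

theorem eq_root_mul_of_mem_U [CharZero K] {u : SL3 K} (hu : u ∈ U K) :
    u = root h01 (u 0 1) * root h12 (u 1 2) * root h02 (u 0 2 - u 0 1 * u 1 2) := by
  obtain ⟨h1, h2⟩ := hu
  have a := h2 1 0 (by decide)
  have b := h2 2 0 (by decide)
  have c := h2 2 1 (by decide)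
  apply Subtype.ext
  ext i j
  rw [Matrix.SpecialLinearGroup.coe_mul, Matrix.SpecialLinearGroup.coe_mul, coe_expNil,
    coe_expNil, coe_expNil]
  fin_cases i <;> fin_cases j <;>
    simp [Matrix.mul_apply, Fin.sum_univ_three, Matrix.single_apply, Matrix.one_apply, h1, a, b, c]

/-- A functional on a rational representation that is fixed by `U`. -/
theorem exists_U_invariant_functional [CharZero K] [IsAlgClosed K] [FiniteDimensional K V] [Nontrivial V]
    {ρ : Representation K (SL3 K) V}
    (hρ : ∀ (φ : Module.Dual K V) (v : V), (fun g => φ (ρ g v)) ∈ regSL3 K)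
    {D : sl3 K →ₗ⁅K⁆ Module.End K V} (hD : IsDifferential ρ D) :
    ∃ φ : Module.Dual K V, φ ≠ 0 ∧ ∀ u ∈ U K, ∀ v, φ (ρ u v) = φ v := by
  -- Transposition reverses products: on the dual space the transpose of `E_ij` raises the
  -- eigenvalues of minus the transpose of `h/2` by `j - i`.
  have hrel {i j : Fin 3} (h : i ≠ j) (hij : i < j) (c : ℕ) (hc : (i : ℕ) + c = j) :
      -(D (halfH K)).dualMap * (D (rootVector K h)).dualMap
        - (D (rootVector K h)).dualMap * -(D (halfH K)).dualMap
        = (c : K) • (D (rootVector K h)).dualMap := by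
    have h1 : D (halfH K) * D (rootVector K h) - D (rootVector K h) * D (halfH K)
        = (c : K) • D (rootVector K h) := by
      rw [← LieRing.of_associative_ring_bracket, ← LieHom.map_lie, lie_halfH_rootVector, map_smul,
        ← hc]
      simp
    ext φ v
    have := congrArg φ (LinearMap.congr_fun h1 v)
    simp only [LinearMap.sub_apply, Module.End.mul_apply, map_sub, LinearMap.smul_apply,
      map_smul] at this
    simp only [LinearMap.sub_apply, Module.End.mul_apply, LinearMap.smul_apply,
      LinearMap.neg_apply, LinearMap.dualMap_apply, map_neg, ← this]
    ring
  obtain ⟨φ, μ, hφ0, -, hφ⟩ := exists_eigenvector_of_raising (ι := Fin 3)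
    (-(D (halfH K)).dualMap)
    ![(D (rootVector K h01)).dualMap, (D (rootVector K h12)).dualMap,
      (D (rootVector K h02)).dualMap] ![1, 1, 2] (by decide) (by
      intro i
      fin_cases i
      · exact hrel h01 (by decide) 1 rfl
      · exact hrel h12 (by decide) 1 rfl
      · exact hrel h02 (by decide) 2 rfl)
  have hfix {i j : Fin 3} (h : i ≠ j) (h0 : (D (rootVector K h)).dualMap φ = 0) (t : K) (v : V) :
      φ (ρ (root h t) v) = φ v :=
    hD.isLinearDifferential.eval_eq_of_apply_eq_zero hρ (rootVector_sq h)
      (φ := φ) (v := v) (fun s => LinearMap.congr_fun h0 (ρ (root h s) v)) t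
  refine ⟨φ, hφ0, fun u hu v => ?_⟩
  rw [eq_root_mul_of_mem_U hu, map_mul, map_mul, Module.End.mul_apply, Module.End.mul_apply,
    hfix h01 (hφ 0), hfix h12 (hφ 1), hfix h02 (hφ 2)]

theorem eq_bot_or_eq_top_of_irreducible {ρ : Representation K (SL3 K) V} (h : ρ.IsIrreducible)
    {S : Submodule K V} (hS : ∀ g, ∀ v ∈ S, ρ g v ∈ S) : S = ⊥ ∨ S = ⊤ := by
  let S' : Subrepresentation ρ := ⟨S, fun g v hv => hS g v hv⟩
  obtain h' | h' := h.eq_bot_or_eq_top S'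
  · exact .inl (congrArg Subrepresentation.toSubmodule h')
  · exact .inr (congrArg Subrepresentation.toSubmodule h')

/-- An irreducible representation is spanned by the orbit of any nonzero vector. -/
theorem functional_eq_zero_of_orbit {ρ : Representation K (SL3 K) V} (h : ρ.IsIrreducible)
    {v : V} (hv : v ≠ 0) {φ : Module.Dual K V} (hφ : ∀ g, φ (ρ g v) = 0) : φ = 0 := by
  have hS := eq_bot_or_eq_top_of_irreducible h
    (S := Submodule.span K (Set.range fun g => ρ g v)) (fun g w hw => by
      induction hw using Submodule.span_induction with
      | mem w hw =>
        obtain ⟨s, rfl⟩ := hw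
        exact Submodule.subset_span ⟨g * s, by simp⟩
      | zero => simp
      | add x y _ _ hx hy => simpa using Submodule.add_mem _ hx hy
      | smul c x _ hx => simpa using Submodule.smul_mem _ c hx)
  have hmem : v ∈ Submodule.span K (Set.range fun g => ρ g v) :=
    Submodule.subset_span ⟨1, by simp⟩
  obtain hS | hS := hS
  · rw [hS] at hmem
    exact absurd ((Submodule.mem_bot K).1 hmem) hv
  · ext w
    have hw : w ∈ Submodule.span K (Set.range fun g => ρ g v) := hS ▸ Submodule.mem_top
    have : Submodule.span K (Set.range fun g => ρ g v) ≤ LinearMap.ker φ :=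
      Submodule.span_le.2 (by rintro _ ⟨g, rfl⟩; exact hφ g)
    exact this hw

section Torus

variable {t : SL3 K}

theorem mul_torus_apply (ht : t ∈ T K) (g : SL3 K) (i j : Fin 3) :
    (g * t) i j = g i j * t j j := by
  rw [Matrix.SpecialLinearGroup.coe_mul, Matrix.mul_apply, Finset.sum_eq_single j]
  · intro k _ hk
    rw [ht k j hk, mul_zero]
  · simp

theorem torus_mul_apply (ht : t ∈ T K) (g : SL3 K) (i j : Fin 3) :
    (t * g) i j = t i i * g i j := by
  rw [Matrix.SpecialLinearGroup.coe_mul, Matrix.mul_apply, Finset.sum_eq_single i]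
  · intro k _ hk
    rw [ht i k hk.symm, zero_mul]
  · simp

theorem torus_inv_mul (ht : t ∈ T K) (i : Fin 3) : t⁻¹ i i * t i i = 1 := by
  rw [← mul_torus_apply ht, inv_mul_cancel]
  simp

theorem torus_prod (ht : t ∈ T K) : t 0 0 * t 1 1 * t 2 2 = 1 := by
  have := t.2
  rw [Matrix.det_fin_three] at this
  change t 0 0 * t 1 1 * t 2 2 - t 0 0 * t 1 2 * t 2 1 - t 0 1 * t 1 0 * t 2 2 +
    t 0 1 * t 1 2 * t 2 0 + t 0 2 * t 1 0 * t 2 1 - t 0 2 * t 1 1 * t 2 0 = 1 at this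
  rw [ht 1 2 (by decide), ht 0 1 (by decide), ht 0 2 (by decide)] at this
  simpa using this

/-- The diagonal matrix `diag(r, s, (rs)⁻¹)`. -/
def torusElt (r s : K) (hr : r ≠ 0) (hs : s ≠ 0) : SL3 K :=
  ⟨Matrix.diagonal ![r, s, (r * s)⁻¹], by
    rw [Matrix.det_diagonal, Fin.prod_univ_three]
    exact mul_inv_cancel₀ (mul_ne_zero hr hs)⟩

theorem torusElt_mem (r s : K) (hr : r ≠ 0) (hs : s ≠ 0) : torusElt r s hr hs ∈ T K :=
  fun _ _ hij => Matrix.diagonal_apply_ne _ hij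

end Torus

end HighestWeight

/-! ### Realization of representations in functions on `SL₃`. -/

section Realization

variable {K : Type*} [Field K]

/-- Functions on the open cell are determined by their invariance under `U` on both sides and by
their weight under right multiplication by `T`. -/
theorem eq_smul_of_biinvariant [CharZero K] {F : SL3 K → K} (hF : F ∈ regSL3 K)
    (hr : ∀ g : SL3 K, ∀ u ∈ U K, F (g * u) = F g) (hl : ∀ u ∈ U K, ∀ g, F (u * g) = F g)
    {a b : ℕ} (ht : ∀ t ∈ T K, ∀ g : SL3 K, F (g * t) = t 0 0 ^ (a + b) * t 1 1 ^ b * F g) :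
    ∃ c : K, ∀ g : SL3 K, F g = c * (g⁻¹ 2 0 ^ b * g 2 0 ^ a) := by
  -- A representative of the longest Weyl group element. On the big cell, `g` lies in `u m t U` with
  -- `t = diag(ξ₃, x₁/ξ₃, 1/x₁)`; the factors `t` and `u` are found from the first column of `g` and
  -- the last row of `g⁻¹`.
  let m : SL3 K := ⟨!![0, 0, 1; 0, -1, 0; 1, 0, 0], by
    rw [Matrix.det_fin_three]
    change 0 * -1 * 0 - 0 * 0 * 0 - 0 * 0 * 0 + 0 * 0 * 1 + 1 * 0 * 0 - 1 * -1 * 1 = (1 : K)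
    ring⟩
  refine ⟨F m, fun g => ?_⟩
  have hreg : (fun g : SL3 K => F m * (g⁻¹ 2 0 ^ b * g 2 0 ^ a)) ∈ regSL3 K :=
    (regSL3 K).smul_mem (mul_mem (pow_mem (inv_entry_mem_regSL3 2 0) b)
      (pow_mem (entry_mem_regSL3 2 0) a)) (F m)
  refine congrFun (eq_of_eqOn_bigCell hF hreg fun g h0 h3 => ?_) g
  have hq : g 2 0 / g⁻¹ 2 0 ≠ 0 := div_ne_zero h3 h0
  set t : SL3 K := torusElt (g 2 0) (g⁻¹ 2 0 / g 2 0) h3 (div_ne_zero h0 h3) with ht_def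
  have htT : t ∈ T K := torusElt_mem _ _ _ _
  let u : SL3 K := ⟨!![1, -g⁻¹ 2 1 / g⁻¹ 2 0, g 0 0 / g 2 0; 0, 1, g 1 0 / g 2 0; 0, 0, 1], by
    rw [Matrix.det_fin_three]
    change 1 * 1 * 1 - 1 * (g 1 0 / g 2 0) * 0 - -g⁻¹ 2 1 / g⁻¹ 2 0 * 0 * 1 +
      -g⁻¹ 2 1 / g⁻¹ 2 0 * (g 1 0 / g 2 0) * 0 + g 0 0 / g 2 0 * 0 * 0
      - g 0 0 / g 2 0 * 1 * 0 = 1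
    ring⟩
  have hu : u ∈ U K := by
    constructor
    · intro i
      fin_cases i <;> rfl
    · intro i j hij
      fin_cases i <;> fin_cases j <;> first
        | exact absurd hij (by decide)
        | rfl
  have e00 : t 0 0 = g 2 0 := rfl
  have e11 : t 1 1 = g⁻¹ 2 0 / g 2 0 := rfl
  have hcol (i : Fin 3) : g i 0 = (u * (m * t)) i 0 := by
    have hmt (k : Fin 3) : (m * t) k 0 = m k 0 * g 2 0 := mul_torus_apply htT m k 0
    rw [Matrix.SpecialLinearGroup.coe_mul, Matrix.mul_apply, Fin.sum_univ_three, hmt, hmt, hmt]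
    fin_cases i
    · change g 0 0 = 1 * (0 * g 2 0) + -g⁻¹ 2 1 / g⁻¹ 2 0 * (0 * g 2 0) + g 0 0 / g 2 0 * (1 * g 2 0)
      field_simp
      ring
    · change g 1 0 = 0 * (0 * g 2 0) + 1 * (0 * g 2 0) + g 1 0 / g 2 0 * (1 * g 2 0)
      field_simp
      ring
    · change g 2 0 = 0 * (0 * g 2 0) + 0 * (0 * g 2 0) + 1 * (1 * g 2 0)
      ring
  have hmt1 (k : Fin 3) : (m * t) k 1 = m k 1 * (g⁻¹ 2 0 / g 2 0) := mul_torus_apply htT m k 1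
  have hcol1 (i : Fin 3) : (u * (m * t)) i 1 = -u i 1 * (g⁻¹ 2 0 / g 2 0) := by
    rw [Matrix.SpecialLinearGroup.coe_mul, Matrix.mul_apply, Fin.sum_univ_three, hmt1, hmt1, hmt1]
    change u i 0 * (0 * _) + u i 1 * (-1 * _) + u i 2 * (0 * _) = _
    ring
  have r0 : g⁻¹ 2 0 = (u * (m * t))⁻¹ 2 0 := by
    rw [inv_two_zero (u * (m * t)), ← hcol, ← hcol, hcol1, hcol1]
    change _ = g 1 0 * (-0 * (g⁻¹ 2 0 / g 2 0)) - -1 * (g⁻¹ 2 0 / g 2 0) * g 2 0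
    field_simp
    ring
  have r1 : g⁻¹ 2 1 = (u * (m * t))⁻¹ 2 1 := by
    rw [inv_two_one (u * (m * t)), ← hcol, ← hcol, hcol1, hcol1]
    change _ = -(g 0 0 * (-0 * (g⁻¹ 2 0 / g 2 0)))
      + -(-g⁻¹ 2 1 / g⁻¹ 2 0) * (g⁻¹ 2 0 / g 2 0) * g 2 0
    field_simp
    ring
  have r2 : g⁻¹ 2 2 = (u * (m * t))⁻¹ 2 2 := by
    have q1 := sum_inv_mul_eq_zero g
    have q2 := sum_inv_mul_eq_zero (u * (m * t))
    rw [← hcol, ← hcol, ← hcol, ← r0, ← r1] at q2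
    exact mul_right_cancel₀ h3 (by linear_combination q1 - q2)
  have hrow (j : Fin 3) : g⁻¹ 2 j = (u * (m * t))⁻¹ 2 j := by
    fin_cases j <;> assumption
  rw [eq_of_right_invariant hr hcol hrow, hl u hu, ht t htT, e00, e11, div_pow, pow_add]
  field_simp

/-- The monomial `x₁ ^ p * x₂ ^ q * ξ₂ ^ r * ξ₃ ^ s`, as a function on `SL₃`. -/
def monomialFun (p q r s : ℕ) (g : SL3 K) : K :=
  g⁻¹ 2 0 ^ p * g⁻¹ 2 1 ^ q * g 1 0 ^ r * g 2 0 ^ s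

variable {V : Type*} [AddCommGroup V] [Module K V] {ρ : Representation K (SL3 K) V}

/-- The realization of a representation in functions on `SL₃` given by a functional. -/
def realization (ρ : Representation K (SL3 K) V) (φ : Module.Dual K V) : V →ₗ[K] (SL3 K → K) where
  toFun w g := φ (ρ g⁻¹ w)
  map_add' _ _ := by ext; simp
  map_smul' _ _ := by ext; simp

theorem realization_apply (φ : Module.Dual K V) (w : V) (g : SL3 K) :
    realization ρ φ w g = φ (ρ g⁻¹ w) := rfl

theorem realization_equivariant (φ : Module.Dual K V) (s : SL3 K) (w : V) (g : SL3 K) :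
    realization ρ φ (ρ s w) g = realization ρ φ w (s⁻¹ * g) := by
  simp [realization_apply]

theorem realization_injective (h : ρ.IsIrreducible) {φ : Module.Dual K V} (hφ : φ ≠ 0) :
    Function.Injective (realization ρ φ) := by
  refine (injective_iff_map_eq_zero _).2 fun v hv => ?_
  by_contra hne
  refine hφ (functional_eq_zero_of_orbit h hne fun g => ?_)
  simpa [realization_apply] using congrFun hv g⁻¹

/-- The action of `sl₃` on a monomial. -/
theorem realization_differential [CharZero K]
    (hρ : ∀ (φ : Module.Dual K V) (v : V), (fun g => φ (ρ g v)) ∈ regSL3 K)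
    {D : sl3 K →ₗ⁅K⁆ Module.End K V} (hD : IsDifferential ρ D) {φ : Module.Dual K V} {w : V}
    {p q r s : ℕ} (hw : realization ρ φ w = monomialFun p q r s) (X : sl3 K) (g : SL3 K) :
    realization ρ φ (D X w) g =
      p * g⁻¹ 2 0 ^ (p - 1) * g⁻¹ 2 1 ^ q * g 1 0 ^ r * g 2 0 ^ s * ∑ k, g⁻¹ 2 k * X.1 k 0
      + q * g⁻¹ 2 0 ^ p * g⁻¹ 2 1 ^ (q - 1) * g 1 0 ^ r * g 2 0 ^ s * ∑ k, g⁻¹ 2 k * X.1 k 1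
      - r * g⁻¹ 2 0 ^ p * g⁻¹ 2 1 ^ q * g 1 0 ^ (r - 1) * g 2 0 ^ s * ∑ k, X.1 1 k * g k 0
      - s * g⁻¹ 2 0 ^ p * g⁻¹ 2 1 ^ q * g 1 0 ^ r * g 2 0 ^ (s - 1) * ∑ k, X.1 2 k * g k 0 := by
  -- Both sides are linear in `X`, so square-zero `N` suffice, and along `(1 - tN)g` the functions
  -- `x_j`, `ξ_i` are affine in `t`. The truncated exponents `p - 1` are harmless, being multiplied
  -- by `p`.
  let f : sl3 K →ₗ[K] K :=
    { toFun := fun X => realization ρ φ (D X w) g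
      map_add' := fun X Y => by simp
      map_smul' := fun c X => by simp }
  let f' : sl3 K →ₗ[K] K :=
    { toFun := fun X =>
        p * g⁻¹ 2 0 ^ (p - 1) * g⁻¹ 2 1 ^ q * g 1 0 ^ r * g 2 0 ^ s * ∑ k, g⁻¹ 2 k * X.1 k 0
        + q * g⁻¹ 2 0 ^ p * g⁻¹ 2 1 ^ (q - 1) * g 1 0 ^ r * g 2 0 ^ s * ∑ k, g⁻¹ 2 k * X.1 k 1
        - r * g⁻¹ 2 0 ^ p * g⁻¹ 2 1 ^ q * g 1 0 ^ (r - 1) * g 2 0 ^ s * ∑ k, X.1 1 k * g k 0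
        - s * g⁻¹ 2 0 ^ p * g⁻¹ 2 1 ^ q * g 1 0 ^ r * g 2 0 ^ (s - 1) * ∑ k, X.1 2 k * g k 0
      map_add' := fun X Y => by
        have e (i j) : (X + Y).1 i j = X.1 i j + Y.1 i j := rfl
        simp only [e, Fin.sum_univ_three]
        ring
      map_smul' := fun c X => by
        have e (i j) : (c • X).1 i j = c * X.1 i j := rfl
        simp only [e, smul_eq_mul, RingHom.id_apply, Fin.sum_univ_three]
        ring }
  refine LinearMap.congr_fun (sl3_linearMap_ext (f := f) (f' := f') fun N hN => ?_) X
  let A : Fin 3 → K := fun j => ∑ k, g⁻¹ 2 k * N.1 k j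
  let B : Fin 3 → K := fun i => ∑ k, N.1 i k * g k 0
  let x : Fin 3 → Polynomial K := fun j =>
    Polynomial.C (g⁻¹ 2 j) + Polynomial.C (A j) * Polynomial.X
  let ξ : Fin 3 → Polynomial K := fun i =>
    Polynomial.C (g i 0) - Polynomial.C (B i) * Polynomial.X
  have h := hD.isLinearDifferential.apply_of_sq_eq_zero hρ hN (φ := φ ∘ₗ ρ g⁻¹) (v := w)
    (q := x 0 ^ p * x 1 ^ q * ξ 1 ^ r * ξ 2 ^ s) fun t => by
      have h1 : (φ ∘ₗ ρ g⁻¹) (ρ (expNil hN t) w) = monomialFun p q r s (expNil hN (-t) * g) := by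
        rw [← hw, ← expNil_inv, ← realization_equivariant]
        rfl
      have hx (j : Fin 3) : (expNil hN (-t) * g)⁻¹ 2 j = (x j).eval t := by
        have e : (x j).eval t = g⁻¹ 2 j + A j * t := by
          simp [x, -Matrix.SpecialLinearGroup.coe_inv]
        have e' : ((g⁻¹ : SL3 K).1 * N.1) 2 j = A j := Matrix.mul_apply
        rw [mul_inv_rev, expNil_inv, neg_neg, Matrix.SpecialLinearGroup.coe_mul, coe_expNil,
          Matrix.mul_add, Matrix.mul_one, Matrix.mul_smul, Matrix.add_apply, Matrix.smul_apply, e',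
          e, smul_eq_mul, mul_comm t]
      have hξ (i : Fin 3) : (expNil hN (-t) * g) i 0 = (ξ i).eval t := by
        have e : (ξ i).eval t = g i 0 - B i * t := by simp [ξ]
        have e' : (N.1 * g.1) i 0 = B i := Matrix.mul_apply
        rw [Matrix.SpecialLinearGroup.coe_mul, coe_expNil, Matrix.add_mul, Matrix.one_mul,
          Matrix.smul_mul, Matrix.add_apply, Matrix.smul_apply, e', e, smul_eq_mul]
        ring
      rw [h1, monomialFun, hx, hx, hξ, hξ]
      simp
  refine h.trans ?_
  have hx0 (j) : (x j).eval 0 = g⁻¹ 2 j := by simp [x, -Matrix.SpecialLinearGroup.coe_inv]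
  have hξ0 (i) : (ξ i).eval 0 = g i 0 := by simp [ξ]
  have hxd (j) : (x j).derivative.eval 0 = A j := by simp [x]
  have hξd (i) : (ξ i).derivative.eval 0 = -B i := by simp [ξ]
  simp only [Polynomial.derivative_mul, Polynomial.derivative_pow, Polynomial.eval_add,
    Polynomial.eval_mul, Polynomial.eval_pow, hx0, hξ0, hxd, hξd, Polynomial.eval_C]
  change _ = p * g⁻¹ 2 0 ^ (p - 1) * g⁻¹ 2 1 ^ q * g 1 0 ^ r * g 2 0 ^ s * A 0
      + q * g⁻¹ 2 0 ^ p * g⁻¹ 2 1 ^ (q - 1) * g 1 0 ^ r * g 2 0 ^ s * A 1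
      - r * g⁻¹ 2 0 ^ p * g⁻¹ 2 1 ^ q * g 1 0 ^ (r - 1) * g 2 0 ^ s * B 1
      - s * g⁻¹ 2 0 ^ p * g⁻¹ 2 1 ^ q * g 1 0 ^ r * g 2 0 ^ (s - 1) * B 2
  ring

end Realization

/-! ### The invariants of `R(a,b)` as monomials of bidegree `(a, b)`. -/

section Monomials

variable {K : Type*} [Field K] {V : Type*} [AddCommGroup V] [Module K V]
  {ρ : Representation K (SL3 K) V} {φ : Module.Dual K V} {a b : ℕ}

/-- The functional `φ` realizes `ρ` inside the functions on `SL₃/U` that have degree `a` in the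
coordinates `x` and degree `b` in the coordinates `ξ`. -/
structure IsRealization (ρ : Representation K (SL3 K) V) (φ : Module.Dual K V) (a b : ℕ) :
    Prop where
  injective : Function.Injective (realization ρ φ)
  mem : ∀ w, realization ρ φ w ∈ regSL3modU K
  weight : ∀ t ∈ T K, ∀ w g,
    realization ρ φ w (g * t) = t⁻¹ 2 2 ^ a * t 0 0 ^ b * realization ρ φ w g
  highest : ∃ v, realization ρ φ v = monomialFun a 0 0 b

/-- For a `U`-fixed functional `φ` and the highest weight vector `v`, the function `g ↦ φ(gv)` is
invariant on both sides under `U`, hence equals `c x₁^b ξ₃^a`. Here `c ≠ 0` because the orbit of `v`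
spans; `φ` is rescaled to `c = 1`, and passing to `g⁻¹` exchanges `x₁` and `ξ₃`. -/
theorem IsSimpleOfHighestWeight.exists_isRealization [IsAlgClosed K] [CharZero K]
    (hV : IsSimpleOfHighestWeight ρ a b) : ∃ φ, IsRealization ρ φ a b := by
  have := hV.finite
  obtain ⟨D, hD⟩ := exists_isDifferential hV.rational
  obtain ⟨v, hv0, hvU, hvT⟩ := hV.highest
  have : Nontrivial V := ⟨v, 0, hv0⟩
  obtain ⟨φ, hφ0, hφU⟩ := exists_U_invariant_functional hV.rational hD
  obtain ⟨c, hc⟩ := eq_smul_of_biinvariant (F := fun g => φ (ρ g v)) (hV.rational φ v)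
    (fun g u hu => by simp [hvU u hu]) (fun u hu g => by simp [hφU u hu]) (a := a) (b := b)
    (fun t ht g => by simp [hvT t ht])
  have hc0 : c ≠ 0 := by
    rintro rfl
    exact hφ0 (functional_eq_zero_of_orbit hV.irreducible hv0 fun g => by simpa using hc g)
  set ψ : Module.Dual K V := c⁻¹ • φ with hψ
  have hψ0 : ψ ≠ 0 := smul_ne_zero (inv_ne_zero hc0) hφ0
  have hψU (u : SL3 K) (hu : u ∈ U K) (w : V) : ψ (ρ u w) = ψ w := by
    simp [hψ, hφU u hu]
  have hψv (g : SL3 K) : ψ (ρ g v) = g⁻¹ 2 0 ^ b * g 2 0 ^ a := by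
    rw [hψ, LinearMap.smul_apply, hc, smul_eq_mul, inv_mul_cancel_left₀ hc0]
  -- The weight of `ψ` is not part of its choice: both sides agree on the orbit of `v`, which spans
  -- `V`.
  have hψT (t : SL3 K) (ht : t ∈ T K) (w : V) :
      ψ (ρ t w) = t⁻¹ 0 0 ^ b * t 2 2 ^ a * ψ w := by
    have hz : ψ ∘ₗ ρ t - (t⁻¹ 0 0 ^ b * t 2 2 ^ a) • ψ = 0 := by
      refine functional_eq_zero_of_orbit hV.irreducible hv0 fun g => ?_
      rw [LinearMap.sub_apply, LinearMap.comp_apply, ← Module.End.mul_apply, ← map_mul, hψv,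
        LinearMap.smul_apply, hψv, torus_mul_apply ht, mul_inv_rev, mul_torus_apply (inv_mem ht),
        smul_eq_mul]
      ring
    exact sub_eq_zero.1 (LinearMap.congr_fun hz w)
  refine ⟨ψ, realization_injective hV.irreducible hψ0, fun w => ⟨?_, fun g u hu => ?_⟩,
    fun t ht w g => ?_, v, ?_⟩
  · exact comp_inv_mem_regSL3 (hV.rational ψ w)
  · rw [realization_apply, mul_inv_rev, map_mul, Module.End.mul_apply, hψU _ (inv_mem hu)]
    rfl
  · rw [realization_apply, mul_inv_rev, map_mul, Module.End.mul_apply, hψT _ (inv_mem ht), inv_inv]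
    rw [realization_apply]
    ring
  · ext g
    rw [realization_apply, hψv, inv_inv, monomialFun]
    ring

theorem coeff_aeval_C_mul_X {σ : Type*} [Fintype σ] (c : σ → K) (P : MvPolynomial σ K)
    (d : σ →₀ ℕ) :
    (MvPolynomial.aeval (fun i => MvPolynomial.C (c i) * MvPolynomial.X (R := K) i) P).coeff d
      = (∏ i, c i ^ d i) * P.coeff d := by
  classical
  induction P using MvPolynomial.induction_on' with
  | monomial e r =>
    have : MvPolynomial.aeval (fun i => MvPolynomial.C (c i) * MvPolynomial.X (R := K) i)
        (MvPolynomial.monomial e r) = MvPolynomial.monomial e (r * ∏ i, c i ^ e i) := by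
      rw [MvPolynomial.aeval_monomial, Finsupp.prod_fintype _ _ (by simp)]
      simp only [mul_pow, Finset.prod_mul_distrib, MvPolynomial.algebraMap_eq]
      rw [MvPolynomial.monomial_eq, Finsupp.prod_fintype _ _ (by simp)]
      simp only [map_mul, map_prod, map_pow]
      ring
    rw [this, MvPolynomial.coeff_monomial, MvPolynomial.coeff_monomial]
    split_ifs with h
    · rw [h, mul_comm]
    · rw [mul_zero]
  | add p q hp hq => rw [map_add, MvPolynomial.coeff_add, hp, hq, MvPolynomial.coeff_add, mul_add]

theorem generators_mul_torus {t : SL3 K} (ht : t ∈ T K) (g : SL3 K) (i : Fin 4) :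
    generators K i (g * t)
      = (![t⁻¹ 2 2, t⁻¹ 2 2, t 0 0, t 0 0] : Fin 4 → K) i * generators K i g := by
  have hx (j : Fin 3) : (g * t)⁻¹ 2 j = t⁻¹ 2 2 * g⁻¹ 2 j := by
    rw [mul_inv_rev, torus_mul_apply (inv_mem ht)]
  have hξ (j : Fin 3) : (g * t) j 0 = t 0 0 * g j 0 := by
    rw [mul_torus_apply ht, mul_comm]
  fin_cases i
  · exact hx 0
  · exact hx 1
  · exact hξ 1
  · exact hξ 2

/-- The exponents of a polynomial in the generators that has a weight under the right action of the
torus. -/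
theorem prod_pow_eq_of_coeff_ne_zero [CharZero K] {P : MvPolynomial (Fin 4) K} {t : SL3 K}
    (ht : t ∈ T K) {χ : K}
    (h : ∀ g, MvPolynomial.aeval (generators K) P (g * t)
      = χ * MvPolynomial.aeval (generators K) P g) {d : Fin 4 →₀ ℕ} (hd : P.coeff d ≠ 0) :
    t⁻¹ 2 2 ^ (d 0 + d 1) * t 0 0 ^ (d 2 + d 3) = χ := by
  let c : Fin 4 → K := ![t⁻¹ 2 2, t⁻¹ 2 2, t 0 0, t 0 0]
  -- Right translation by `t` rescales the generators, so algebraic independence turns the weight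
  -- condition into an identity of polynomials, compared coefficient by coefficient.
  have key : MvPolynomial.aeval (fun i => MvPolynomial.C (c i) * MvPolynomial.X (R := K) i) P
      = MvPolynomial.C χ * P := by
    refine sub_eq_zero.1 ((algebraicIndependent_iff.1 algebraicIndependent_generators) _ ?_)
    ext g
    rw [map_sub, Pi.sub_apply, map_mul, Pi.mul_apply, MvPolynomial.aeval_C]
    change _ - χ * MvPolynomial.aeval (generators K) P g = 0
    rw [← h g, aeval_generators_apply, aeval_generators_apply]
    refine sub_eq_zero.2 ?_
    simp only [generators_mul_torus ht]
    change _ = MvPolynomial.eval (fun i => c i * generators K i g) P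
    clear h hd
    induction P using MvPolynomial.induction_on with
    | C r => simp
    | add p q hp hq => rw [map_add, map_add, map_add, hp, hq]
    | mul_X p i hp => rw [map_mul, map_mul, hp, map_mul]; simp
  have h1 := congrArg (MvPolynomial.coeff d) key
  rw [coeff_aeval_C_mul_X, MvPolynomial.coeff_C_mul] at h1
  rw [← mul_right_cancel₀ hd h1, Fin.prod_univ_four]
  change _ = t⁻¹ 2 2 ^ d 0 * t⁻¹ 2 2 ^ d 1 * t 0 0 ^ d 2 * t 0 0 ^ d 3
  ring

theorem aeval_generators_monomial (d : Fin 4 →₀ ℕ) :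
    MvPolynomial.aeval (generators K) (MvPolynomial.monomial d (1 : K))
      = monomialFun (d 0) (d 1) (d 2) (d 3) := by
  ext g
  rw [aeval_generators_apply, MvPolynomial.eval_monomial, Finsupp.prod_fintype _ _ (by simp),
    Fin.prod_univ_four, one_mul]
  rfl

/-- The monomials of degree `a` in `x₁, x₂` and degree `b` in `ξ₂, ξ₃`, indexed by the exponents of
`x₁` and `ξ₃`. -/
def monomialFamily (K : Type*) [Field K] (a b : ℕ) (x : Fin (a + 1) × Fin (b + 1)) : SL3 K → K :=
  monomialFun x.1 (a - x.1) (b - x.2) x.2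

theorem linearIndependent_monomialFamily [CharZero K] (a b : ℕ) :
    LinearIndependent K (monomialFamily K a b) := by
  have h1 := (MvPolynomial.basisMonomials (Fin 4) K).linearIndependent.map'
    (MvPolynomial.aeval (generators K)).toLinearMap
    (LinearMap.ker_eq_bot.2 (algebraicIndependent_iff_injective_aeval.1
      algebraicIndependent_generators))
  let e : Fin (a + 1) × Fin (b + 1) → (Fin 4 →₀ ℕ) := fun x =>
    Finsupp.equivFunOnFinite.symm ![x.1, a - x.1, b - x.2, x.2]
  have he : Function.Injective e := by
    intro x y hxy
    have h0 : (x.1 : ℕ) = y.1 := DFunLike.congr_fun hxy 0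
    have h3 : (x.2 : ℕ) = y.2 := DFunLike.congr_fun hxy 3
    exact Prod.ext (Fin.ext h0) (Fin.ext h3)
  have heq : monomialFamily K a b = ((MvPolynomial.aeval (generators K)).toLinearMap ∘
      MvPolynomial.basisMonomials (Fin 4) K) ∘ e := by
    ext1 x
    simp only [Function.comp_apply, MvPolynomial.coe_basisMonomials]
    exact (aeval_generators_monomial (e x)).symm
  rw [heq]
  exact h1.comp e he

namespace IsRealization

variable [CharZero K]

theorem mem_span_monomialFamily (h : IsRealization ρ φ a b) {w : V}
    (hw : w ∈ InvSpace ρ) :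
    realization ρ φ w ∈ Submodule.span K (Set.range (monomialFamily K a b)) := by
  rw [mem_invSpace_iff] at hw
  obtain ⟨P, hP⟩ := exists_aeval_generators_eq (F := realization ρ φ w) ⟨h.mem w, fun u hu g => by
    rw [← realization_equivariant, hw u hu]⟩
  have two : (2 : K) ≠ 0 := two_ne_zero
  -- `diag(1, 2, 1/2)` detects only the degree in `x` and `diag(2, 1/2, 1)` only the degree in `ξ`;
  -- powers of `2` are distinct in characteristic zero.
  have hdeg (d : Fin 4 →₀ ℕ) (hd : P.coeff d ≠ 0) : d 0 + d 1 = a ∧ d 2 + d 3 = b := by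
    have key (t : SL3 K) (ht : t ∈ T K) :=
      prod_pow_eq_of_coeff_ne_zero ht (fun g => by rw [hP]; exact h.weight t ht w g) hd
    constructor
    · have h1 := key _ (torusElt_mem 1 2 one_ne_zero two)
      have h2 := torus_inv_mul (torusElt_mem 1 2 one_ne_zero two) 2
      have h00 : torusElt (1 : K) 2 one_ne_zero two 0 0 = 1 := rfl
      have h22 : torusElt (1 : K) 2 one_ne_zero two 2 2 = (1 * 2)⁻¹ := rfl
      rw [h22, mul_inv_eq_one₀ (by simp)] at h2
      rw [h2, h00, one_mul, one_pow, one_pow, mul_one, mul_one] at h1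
      exact Nat.pow_right_injective le_rfl (by exact_mod_cast h1)
    · have h1 := key _ (torusElt_mem 2 2⁻¹ two (inv_ne_zero two))
      have h2 := torus_inv_mul (torusElt_mem 2 2⁻¹ two (inv_ne_zero two)) 2
      have h00 : torusElt (2 : K) 2⁻¹ two (inv_ne_zero two) 0 0 = 2 := rfl
      have h22 : torusElt (2 : K) 2⁻¹ two (inv_ne_zero two) 2 2 = (2 * 2⁻¹)⁻¹ := rfl
      rw [h22, mul_inv_cancel₀ two, inv_one, mul_one] at h2
      rw [h2, h00, one_pow, one_pow, one_mul, one_mul] at h1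
      exact Nat.pow_right_injective le_rfl (by exact_mod_cast h1)
  rw [← hP, P.as_sum, map_sum]
  refine Submodule.sum_mem _ fun d hd => ?_
  obtain ⟨ha, hb⟩ := hdeg d (MvPolynomial.mem_support_iff.1 hd)
  have hmono : MvPolynomial.monomial d (P.coeff d)
      = P.coeff d • MvPolynomial.monomial d (1 : K) := by
    rw [MvPolynomial.smul_monomial, smul_eq_mul, mul_one]
  rw [hmono, map_smul, aeval_generators_monomial]
  refine Submodule.smul_mem _ _ (Submodule.subset_span
    ⟨(⟨d 0, by omega⟩, ⟨d 3, by omega⟩), ?_⟩)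
  simp only [monomialFamily]
  rw [show a - d 0 = d 1 by omega, show b - d 3 = d 2 by omega]

/-- All the invariant monomials are in the image of the realization. -/
theorem exists_eq_monomialFun (h : IsRealization ρ φ a b)
    (hρ : ∀ (φ : Module.Dual K V) (v : V), (fun g => φ (ρ g v)) ∈ regSL3 K)
    {D : sl3 K →ₗ⁅K⁆ Module.End K V} (hD : IsDifferential ρ D) :
    ∀ q p r s : ℕ, p + q = a → r + s = b → ∃ w, realization ρ φ w = monomialFun p q r s := by
  intro q
  induction q with
  | zero =>
    intro p r
    induction r with
    | zero =>
      rintro s rfl rfl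
      simpa using h.highest
    | succ r ih =>
      intro s hp hr
      obtain ⟨w, hw⟩ := ih (s + 1) hp (by omega)
      have hs : (s : K) + 1 ≠ 0 := by exact_mod_cast Nat.succ_ne_zero s
      -- With `x₂` absent, the only effect of `E₃₂` is `ξ₃ ↦ -ξ₂`.
      refine ⟨-((s : K) + 1)⁻¹ • D (rootVector K h12.symm) w, ?_⟩
      ext g
      rw [map_smul, Pi.smul_apply, realization_differential hρ hD hw]
      simp only [Matrix.single_apply, Fin.sum_univ_three, LieAlgebra.SpecialLinear.val_single,
        monomialFun]
      simp [-Matrix.SpecialLinearGroup.coe_inv]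
      field_simp
      ring
  | succ q ih =>
    intro p r s hp hr
    obtain ⟨w, hw⟩ := ih (p + 1) r s (by omega) hr
    have hp0 : (p : K) + 1 ≠ 0 := by exact_mod_cast Nat.succ_ne_zero p
    have hp1 : (p : K) + 1 + r + s + 1 ≠ 0 := by exact_mod_cast Nat.succ_ne_zero (p + 1 + r + s)
    have e1 (g : SL3 K) := realization_differential hρ hD hw (rootVector K h01.symm) g
    simp only [Matrix.single_apply, Fin.sum_univ_three, LieAlgebra.SpecialLinear.val_single] at e1
    cases r with
    | zero =>
      refine ⟨((p : K) + 1)⁻¹ • D (rootVector K h01.symm) w, ?_⟩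
      ext g
      rw [map_smul, Pi.smul_apply, e1]
      simp [-Matrix.SpecialLinearGroup.coe_inv, monomialFun]
      field_simp
      ring
    | succ r =>
      obtain ⟨w', hw'⟩ := ih (p + 1) r (s + 1) (by omega) (by omega)
      have e2 (g : SL3 K) := realization_differential hρ hD hw' (rootVector K h02.symm) g
      simp only [Matrix.single_apply, Fin.sum_univ_three, LieAlgebra.SpecialLinear.val_single]
        at e2
      push_cast at hp1
      -- Let `M` be the target and `B = x₁^(p+1) x₂^q ξ₁ ξ₂^r ξ₃^s`. Then `E₂₁w = (p+1)M - (r+1)B`,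
      -- and after eliminating `x₃ξ₃` by the relation, `E₃₁w' = -(p+1)M - (p+s+2)B`. The combination
      -- cancels `B` and leaves `(p+1)(p+r+s+3)M`.
      refine ⟨(((p : K) + 1) * (p + 1 + (r + 1) + s + 1))⁻¹ •
        (((p : K) + 1 + s + 1) • D (rootVector K h01.symm) w
          - ((r : K) + 1) • D (rootVector K h02.symm) w'), ?_⟩
      ext g
      rw [map_smul, map_sub, map_smul, map_smul, Pi.smul_apply, Pi.sub_apply, Pi.smul_apply,
        Pi.smul_apply, e1, e2]
      have hrel := sum_inv_mul_eq_zero g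
      simp [-Matrix.SpecialLinearGroup.coe_inv, monomialFun]
      rw [mul_assoc, inv_mul_eq_iff_eq_mul₀ hp1, inv_mul_eq_iff_eq_mul₀ hp0]
      linear_combination -((r + 1) * (p + 1) * g⁻¹ 2 0 ^ p * g⁻¹ 2 1 ^ q * g 1 0 ^ r * g 2 0 ^ s)
        * hrel

end IsRealization

end Monomials

/-! ### The monomial basis of the invariants and the operators on it. -/

section InvariantBasis

variable {K : Type*} [Field K] {V : Type*} [AddCommGroup V] [Module K V]
  {ρ : Representation K (SL3 K) V} {φ : Module.Dual K V} {a b : ℕ}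

theorem apply_mem_invSpace {u : SL3 K} (hu : u ∈ U K) {v : V} (hv : v ∈ InvSpace ρ) :
    ρ u v ∈ InvSpace ρ :=
  (invRep ρ (QuotientGroup.mk ⟨u, hu⟩) ⟨v, hv⟩).2

/-- A family of vectors of `ρ` that is mapped to the invariant monomials by the realization. -/
structure IsMonomialBasis (ρ : Representation K (SL3 K) V) (φ : Module.Dual K V) (a b : ℕ)
    (w : Fin (a + 1) × Fin (b + 1) → V) : Prop where
  isRealization : IsRealization ρ φ a b
  rational : ∀ (φ : Module.Dual K V) (v : V), (fun g => φ (ρ g v)) ∈ regSL3 K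
  apply : ∀ x, realization ρ φ (w x) = monomialFamily K a b x

theorem IsMonomialBasis.ext {w : Fin (a + 1) × Fin (b + 1) → V}
    (h : IsMonomialBasis ρ φ a b w) {u v : V}
    (huv : ∀ g, realization ρ φ u g = realization ρ φ v g) : u = v :=
  h.isRealization.injective (funext huv)

variable [CharZero K]

/-- The bridge between the two halves: the `U_θ`-invariants are the primitive vectors for `𝔞`. -/
theorem mem_invSpace_iff_apply_eq_zero
    (hρ : ∀ (φ : Module.Dual K V) (v : V), (fun g => φ (ρ g v)) ∈ regSL3 K)
    {D : sl3 K →ₗ⁅K⁆ Module.End K V} (hD : IsDifferential ρ D) (v : V) :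
    v ∈ InvSpace ρ ↔ D (eθ K) v = 0 := by
  rw [mem_invSpace_iff]
  refine Iff.trans ⟨fun h t => h _ (root_mem_Uθ h02 t), fun h u hu => ?_⟩
    (hD.isLinearDifferential.apply_eq_zero_iff hρ (rootVector_sq h02)).symm
  obtain ⟨s, hs⟩ := hu
  have : u = root h02 s :=
    Subtype.ext (hs.trans (by simp [Matrix.transvection, Matrix.smul_single]))
  rw [this]
  exact h s

theorem root_mem_U {i j : Fin 3} (hij : i ≠ j) (hlt : i < j) (t : K) : root hij t ∈ U K := by
  constructor
  · intro k
    fin_cases i <;> fin_cases j <;> fin_cases k <;> simp at hij hlt ⊢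
  · intro k l hkl
    fin_cases i <;> fin_cases j <;> fin_cases k <;> fin_cases l <;> simp at hij hlt hkl ⊢

theorem IsRealization.exists_isMonomialBasis (h : IsRealization ρ φ a b)
    (hρ : ∀ (φ : Module.Dual K V) (v : V), (fun g => φ (ρ g v)) ∈ regSL3 K)
    {D : sl3 K →ₗ⁅K⁆ Module.End K V} (hD : IsDifferential ρ D) :
    ∃ w, IsMonomialBasis ρ φ a b w := by
  choose w hw using fun x : Fin (a + 1) × Fin (b + 1) =>
    h.exists_eq_monomialFun hρ hD (a - x.1) x.1 (b - x.2) x.2 (by omega) (by omega)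
  exact ⟨w, h, hρ, hw⟩

namespace IsMonomialBasis

variable {w : Fin (a + 1) × Fin (b + 1) → V}

theorem linearIndependent (h : IsMonomialBasis ρ φ a b w) : LinearIndependent K w := by
  refine LinearIndependent.of_comp (realization ρ φ) ?_
  have : realization ρ φ ∘ w = monomialFamily K a b := funext h.apply
  rw [this]
  exact linearIndependent_monomialFamily a b

variable {D : sl3 K →ₗ⁅K⁆ Module.End K V}

theorem eθ_apply (h : IsMonomialBasis ρ φ a b w) (hD : IsDifferential ρ D)
    (x : Fin (a + 1) × Fin (b + 1)) : D (eθ K) (w x) = 0 := by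
  refine h.ext fun g => ?_
  rw [realization_differential h.rational hD (h.apply x)]
  simp [eθ]

theorem mem_invSpace (h : IsMonomialBasis ρ φ a b w) (hD : IsDifferential ρ D)
    (x : Fin (a + 1) × Fin (b + 1)) : w x ∈ InvSpace ρ :=
  (mem_invSpace_iff_apply_eq_zero h.rational hD _).2 (h.eθ_apply hD x)

theorem invSpace_eq_span (h : IsMonomialBasis ρ φ a b w) (hD : IsDifferential ρ D) :
    InvSpace ρ = Submodule.span K (Set.range w) := by
  refine le_antisymm (fun v hv => ?_) (Submodule.span_le.2 ?_)
  · have h1 := h.isRealization.mem_span_monomialFamily hv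
    have h2 : Set.range (monomialFamily K a b) = realization ρ φ '' Set.range w := by
      rw [← Set.range_comp]
      exact congrArg Set.range (funext fun x => (h.apply x).symm)
    rw [h2, Submodule.span_image] at h1
    obtain ⟨u, hu, huv⟩ := h1
    rwa [← h.isRealization.injective huv]
  · rintro _ ⟨x, rfl⟩
    exact h.mem_invSpace hD x

theorem finrank_invSpace (h : IsMonomialBasis ρ φ a b w) (hD : IsDifferential ρ D) :
    Module.finrank K (InvSpace ρ) = (a + 1) * (b + 1) := by
  rw [h.invSpace_eq_span hD, finrank_span_eq_card h.linearIndependent]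
  simp

/-- Under `h/2` both `x₁` and `ξ₃` have weight `1`, while `x₂` and `ξ₂` have weight `0`. -/
theorem halfH_apply (h : IsMonomialBasis ρ φ a b w) (hD : IsDifferential ρ D)
    (x : Fin (a + 1) × Fin (b + 1)) :
    D (halfH K) (w x) = (((x.1 : ℕ) + (x.2 : ℕ) : ℕ) : K) • w x := by
  refine h.ext fun g => ?_
  -- At `n = 0` the exponent `n - 1` is truncated to `0`; the factor `n` keeps the identity true.
  have hpow (n : ℕ) (y : K) : (n : K) * y ^ (n - 1) * y = n * y ^ n := by
    cases n with
    | zero => simp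
    | succ n => rw [Nat.add_sub_cancel, mul_assoc, ← pow_succ]
  rw [realization_differential h.rational hD (h.apply x), map_smul, h.apply, Pi.smul_apply]
  have h1 := hpow x.1 (g⁻¹ 2 0)
  have h2 := hpow x.2 (g 2 0)
  simp [halfH, Matrix.single_apply, monomialFamily, monomialFun,
    -Matrix.SpecialLinearGroup.coe_inv]
  linear_combination g⁻¹ 2 1 ^ (a - (x.1 : ℕ)) * g 1 0 ^ (b - (x.2 : ℕ)) *
    (h1 * g 2 0 ^ (x.2 : ℕ) + h2 * g⁻¹ 2 0 ^ (x.1 : ℕ))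

/-- `E₁₂` acts as `x₁∂/∂x₂`; the coefficient is nonzero until `x₂` is used up, which is what makes
`x₂^a ξ₂^b` generate. -/
theorem E₁₂_apply (h : IsMonomialBasis ρ φ a b w) (hD : IsDifferential ρ D) {i : ℕ}
    (hi : i < a) (l : Fin (b + 1)) :
    D (rootVector K h01) (w (⟨i, by omega⟩, l)) = ((a - i : ℕ) : K) • w (⟨i + 1, by omega⟩, l) := by
  refine h.ext fun g => ?_
  rw [realization_differential h.rational hD (h.apply _), map_smul, h.apply, Pi.smul_apply]
  simp [Matrix.single_apply, monomialFamily, monomialFun,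
    -Matrix.SpecialLinearGroup.coe_inv]
  rw [show a - (i + 1) = a - i - 1 by omega]
  ring

theorem E₁₂_apply_last (h : IsMonomialBasis ρ φ a b w) (hD : IsDifferential ρ D)
    (l : Fin (b + 1)) : D (rootVector K h01) (w (⟨a, by omega⟩, l)) = 0 := by
  refine h.ext fun g => ?_
  rw [realization_differential h.rational hD (h.apply _)]
  simp [Matrix.single_apply]

theorem E₂₃_apply (h : IsMonomialBasis ρ φ a b w) (hD : IsDifferential ρ D)
    (i : Fin (a + 1)) {l : ℕ} (hl : l < b) :
    D (rootVector K h12) (w (i, ⟨l, by omega⟩))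
      = -((b - l : ℕ) : K) • w (i, ⟨l + 1, by omega⟩) := by
  refine h.ext fun g => ?_
  rw [realization_differential h.rational hD (h.apply _), map_smul, h.apply, Pi.smul_apply]
  simp [Matrix.single_apply, monomialFamily, monomialFun,
    -Matrix.SpecialLinearGroup.coe_inv]
  rw [show b - (l + 1) = b - l - 1 by omega]
  ring

theorem E₂₃_apply_last (h : IsMonomialBasis ρ φ a b w) (hD : IsDifferential ρ D)
    (i : Fin (a + 1)) : D (rootVector K h12) (w (i, ⟨b, by omega⟩)) = 0 := by
  refine h.ext fun g => ?_
  rw [realization_differential h.rational hD (h.apply _)]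
  simp [Matrix.single_apply]

theorem torus_apply (h : IsMonomialBasis ρ φ a b w) {t : SL3 K} (ht : t ∈ T K)
    (x : Fin (a + 1) × Fin (b + 1)) :
    ρ t (w x) = (t 0 0 ^ (x.1 : ℕ) * t 1 1 ^ (a - x.1) * t⁻¹ 1 1 ^ (b - x.2) *
      t⁻¹ 2 2 ^ (x.2 : ℕ)) • w x := by
  refine h.ext fun g => ?_
  rw [realization_equivariant, map_smul, h.apply, Pi.smul_apply, monomialFamily, monomialFun,
    monomialFun, mul_inv_rev, inv_inv, mul_torus_apply ht, mul_torus_apply ht,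
    torus_mul_apply (inv_mem ht), torus_mul_apply (inv_mem ht), smul_eq_mul]
  ring

/-- A subspace stable under `E₁₂` and `E₂₃` that contains the monomial `x₂ ^ a * ξ₂ ^ b` contains
all the invariant monomials. -/
theorem mem_of_stable (h : IsMonomialBasis ρ φ a b w) (hD : IsDifferential ρ D)
    {S : Submodule K V} (h0 : w (0, 0) ∈ S) (h1 : ∀ v ∈ S, D (rootVector K h01) v ∈ S)
    (h2 : ∀ v ∈ S, D (rootVector K h12) v ∈ S) (x : Fin (a + 1) × Fin (b + 1)) : w x ∈ S := by
  have key1 (i : ℕ) : ∀ hi : i < a + 1, w (⟨i, hi⟩, 0) ∈ S := by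
    induction i with
    | zero => exact fun _ => h0
    | succ i ih =>
      intro hi
      have := h1 _ (ih (by omega))
      rw [h.E₁₂_apply hD (by omega)] at this
      exact (S.smul_mem_iff (Nat.cast_ne_zero.2 (by omega))).1 this
  have key2 (l : ℕ) : ∀ hl : l < b + 1, w (x.1, ⟨l, hl⟩) ∈ S := by
    induction l with
    | zero => exact fun _ => key1 x.1 x.1.2
    | succ l ih =>
      intro hl
      have := h2 _ (ih (by omega))
      rw [h.E₂₃_apply hD _ (by omega)] at this
      exact (S.smul_mem_iff (neg_ne_zero.2 (Nat.cast_ne_zero.2 (by omega)))).1 this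
  exact key2 x.2 x.2.2

/-- The coefficient of `x₂ ^ a * ξ₂ ^ b` is not changed by `U`. -/
theorem functional_apply_U (h : IsMonomialBasis ρ φ a b w) (hD : IsDifferential ρ D)
    {ψ : Module.Dual K V} (hψ : ∀ x, x ≠ (0, 0) → ψ (w x) = 0) {u : SL3 K} (hu : u ∈ U K)
    {v : V} (hv : v ∈ InvSpace ρ) : ψ (ρ u v) = ψ v := by
  -- Each of `E₁₂` and `E₂₃` raises an index of the monomial, so neither has the monomial `(0, 0)`
  -- in its image on the invariants.
  have hkill1 {v : V} (hv : v ∈ InvSpace ρ) : ψ (D (rootVector K h01) v) = 0 := by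
    rw [h.invSpace_eq_span hD] at hv
    have : Submodule.span K (Set.range w) ≤ LinearMap.ker (ψ ∘ₗ D (rootVector K h01)) := by
      refine Submodule.span_le.2 ?_
      rintro _ ⟨⟨⟨i, hi⟩, l⟩, rfl⟩
      change ψ (D (rootVector K h01) (w _)) = 0
      obtain hi' | rfl : i < a ∨ i = a := by omega
      · rw [h.E₁₂_apply hD hi', map_smul, hψ, smul_zero]
        exact fun h' => Nat.succ_ne_zero i (congrArg (fun y => (y.1 : ℕ)) h')
      · rw [h.E₁₂_apply_last hD, map_zero]
    exact this hv
  have hkill2 {v : V} (hv : v ∈ InvSpace ρ) : ψ (D (rootVector K h12) v) = 0 := by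
    rw [h.invSpace_eq_span hD] at hv
    have : Submodule.span K (Set.range w) ≤ LinearMap.ker (ψ ∘ₗ D (rootVector K h12)) := by
      refine Submodule.span_le.2 ?_
      rintro _ ⟨⟨i, ⟨l, hl⟩⟩, rfl⟩
      change ψ (D (rootVector K h12) (w _)) = 0
      obtain hl' | rfl : l < b ∨ l = b := by omega
      · rw [h.E₂₃_apply hD _ hl', map_smul, hψ, smul_zero]
        exact fun h' => Nat.succ_ne_zero l (congrArg (fun y => (y.2 : ℕ)) h')
      · rw [h.E₂₃_apply_last hD, map_zero]
    exact this hv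
  have h02v (t : K) : ρ (root h02 t) v = v :=
    (mem_invSpace_iff ρ v).1 hv _ (root_mem_Uθ h02 t)
  have hd := hD.isLinearDifferential
  rw [eq_root_mul_of_mem_U hu, map_mul, map_mul, Module.End.mul_apply, Module.End.mul_apply, h02v]
  refine (hd.eval_eq_of_apply_eq_zero h.rational (rootVector_sq h01) (φ := ψ)
    (v := ρ (root h12 (u 1 2)) v) (fun s => ?_) _).trans
    (hd.eval_eq_of_apply_eq_zero h.rational (rootVector_sq h12) (φ := ψ) (v := v)
      (fun s => ?_) _)
  · exact hkill1 (apply_mem_invSpace (root_mem_U h01 (by decide) s)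
      (apply_mem_invSpace (root_mem_U h12 (by decide) _) hv))
  · exact hkill2 (apply_mem_invSpace (root_mem_U h12 (by decide) s) hv)

end IsMonomialBasis

end InvariantBasis

/-! ### Counting monomials of given weight. -/

section Multiplicity

/-- A pair is determined by its first entry, which runs from `n - b` to `min a n`; truncated
subtraction supplies the lower bound `0` when `n < b`. -/
theorem card_add_eq (a b n : ℕ) (hn : n < a + b + 1) :
    Fintype.card {x : Fin (a + 1) × Fin (b + 1) // (x.1 : ℕ) + (x.2 : ℕ) = n} =
      branchMult (max a b) (min a b) n := by
  have e : {x : Fin (a + 1) × Fin (b + 1) // (x.1 : ℕ) + (x.2 : ℕ) = n} ≃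
      Finset.Icc (n - b) (min a n) :=
    { toFun := fun x => ⟨x.1.1, by
        have := x.2
        rw [Finset.mem_Icc]
        omega⟩
      invFun := fun i => ⟨(⟨i.1, by
          have := Finset.mem_Icc.1 i.2
          omega⟩, ⟨n - i.1, by
          have := Finset.mem_Icc.1 i.2
          omega⟩), by
        have := Finset.mem_Icc.1 i.2
        simp only
        omega⟩
      left_inv := fun x => by
        have := x.2
        ext
        · rfl
        · simp only
          omega
      right_inv := fun i => rfl }
  rw [Fintype.card_congr e, Fintype.card_coe, Nat.card_Icc, branchMult]
  split_ifs <;> omega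

theorem exists_branching_equiv (a b : ℕ) :
    ∃ e : (Σ n : Fin (a + b + 1), Fin (branchMult (max a b) (min a b) n)) ≃
        Fin (a + 1) × Fin (b + 1), ∀ i, ((e i).1 : ℕ) + ((e i).2 : ℕ) = i.1 := by
  let f (x : Fin (a + 1) × Fin (b + 1)) : Fin (a + b + 1) :=
    ⟨(x.1 : ℕ) + (x.2 : ℕ), by omega⟩
  have hf (n : Fin (a + b + 1)) :
      Fintype.card {x // f x = n} = branchMult (max a b) (min a b) n := by
    rw [← card_add_eq a b n n.2]
    exact Fintype.card_congr (Equiv.subtypeEquivRight fun x => Fin.ext_iff)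
  let e := (Equiv.sigmaCongrRight fun n => (Fintype.equivFinOfCardEq (hf n)).symm).trans
    (Equiv.sigmaFiberEquiv f)
  refine ⟨e, fun i => ?_⟩
  exact Fin.ext_iff.1 ((Fintype.equivFinOfCardEq (hf i.1)).symm i.2).2

end Multiplicity

/-! ### Submodules for `𝔞`. -/

section Submodules

variable {K : Type*} [Field K] {V : Type*} [AddCommGroup V] [Module K V]
  {D : sl3 K →ₗ⁅K⁆ Module.End K V} {S : Submodule K V}

/-- `e` and `E₃₁` generate `𝔞`, because `h/2` is their bracket. -/
theorem isASubmodule_iff : IsASubmodule D S ↔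
    (∀ v ∈ S, D (eθ K) v ∈ S) ∧ ∀ v ∈ S, D (fθ K) v ∈ S := by
  constructor
  · intro h
    exact ⟨h _ (LieSubalgebra.subset_lieSpan (by simp)),
      h _ (LieSubalgebra.subset_lieSpan (by simp))⟩
  · rintro ⟨hE, hF⟩
    let A : LieSubalgebra K (sl3 K) :=
      { carrier := {X | ∀ v ∈ S, D X v ∈ S}
        add_mem' := fun {X Y} hX hY v hv => by
          rw [map_add]
          exact S.add_mem (hX v hv) (hY v hv)
        zero_mem' := fun v _ => by
          rw [map_zero]
          exact S.zero_mem
        smul_mem' := fun c X hX v hv => by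
          rw [map_smul]
          exact S.smul_mem c (hX v hv)
        lie_mem' := fun {X Y} hX hY v hv => by
          have hXY : D ⁅X, Y⁆ v = D X (D Y v) - D Y (D X v) := by
            rw [LieHom.map_lie, LieRing.of_associative_ring_bracket]
            rfl
          rw [hXY]
          exact S.sub_mem (hX _ (hY v hv)) (hY _ (hX v hv)) }
    have hA : aLie K ≤ A := by
      refine LieSubalgebra.lieSpan_le.2 ?_
      rintro X (rfl | rfl | rfl)
      · exact hE
      · rw [← lie_eθ_fθ]
        exact A.lie_mem hE hF
      · exact hF
    exact fun X hX => hA hX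

variable [CharZero K]

/-- A one-dimensional `𝔞`-submodule is trivial. -/
theorem apply_eq_zero_of_finrank_eq_one (hS : IsASubmodule D S)
    (h1 : Module.finrank K S = 1) {v : V} (hv : v ∈ S) :
    D (eθ K) v = 0 ∧ D (halfH K) v = 0 := by
  obtain ⟨v₀, hv₀⟩ := finrank_eq_one_iff'.1 h1
  -- On a line `e` and `E₃₁` act by scalars and so commute, which gives `h/2 = 0` there; then `[h/2,
  -- e] = 2e` gives `e = 0`.
  have hscal (G : Module.End K V) (hG : ∀ v ∈ S, G v ∈ S) : ∃ c : K, ∀ v ∈ S, G v = c • v := by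
    obtain ⟨c, hc⟩ := hv₀.2 ⟨G v₀, hG v₀ v₀.2⟩
    have hc' : c • (v₀ : V) = G v₀ := congrArg Subtype.val hc
    refine ⟨c, fun v hv => ?_⟩
    obtain ⟨d, hd⟩ := hv₀.2 ⟨v, hv⟩
    have hd' : d • (v₀ : V) = v := congrArg Subtype.val hd
    rw [← hd', map_smul, ← hc', smul_comm]
  obtain ⟨hSE, hSF⟩ := isASubmodule_iff.1 hS
  obtain ⟨ε, hε⟩ := hscal _ hSE
  obtain ⟨δ, hδ⟩ := hscal _ hSF
  have r := slTwoRel D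
  have hH : ∀ v ∈ S, D (halfH K) v = 0 := fun v hv => by
    have := r.ef_apply v
    rw [hδ v hv, map_smul, hε v hv, map_smul, hδ v hv, smul_comm] at this
    exact left_eq_add.1 this
  refine ⟨?_, hH v hv⟩
  have := r.he_apply v
  rw [hH _ (hSE v hv), hH v hv, map_zero, zero_add] at this
  exact (smul_eq_zero.1 this.symm).resolve_left two_ne_zero

end Submodules

/-! ### The cyclic vector and the branching rule. -/

namespace IsMonomialBasis

variable {K : Type*} [Field K] [CharZero K] {V : Type*} [AddCommGroup V] [Module K V]
  {ρ : Representation K (SL3 K) V} {φ : Module.Dual K V} {a b : ℕ}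
  {w : Fin (a + 1) × Fin (b + 1) → V} {D : sl3 K →ₗ⁅K⁆ Module.End K V}

/-- The span of the orbit is stable under `U`, hence under `E₁₂` and `E₂₃` by `apply_mem`, and
`mem_of_stable` applies. -/
theorem isCyclicVector (h : IsMonomialBasis ρ φ a b w) (hD : IsDifferential ρ D) :
    IsCyclicVector (invRep ρ) ⟨w (0, 0), h.mem_invSpace hD _⟩ := by
  let w₀ : InvSpace ρ := ⟨w (0, 0), h.mem_invSpace hD _⟩
  let Z := Submodule.span K (Set.range fun g => invRep ρ g w₀)
  have hw₀ : w₀ ∈ Z := Submodule.subset_span ⟨1, by simp⟩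
  have hstab (u : SL3 K) (hu : u ∈ U K) :
      ∀ v ∈ Z.map (InvSpace ρ).subtype, ρ u v ∈ Z.map (InvSpace ρ).subtype := by
    rintro _ ⟨z, hz, rfl⟩
    refine ⟨invRep ρ (QuotientGroup.mk ⟨u, hu⟩) z, ?_, rfl⟩
    have hZ : Z ≤ Z.comap (invRep ρ (QuotientGroup.mk ⟨u, hu⟩)) := by
      refine Submodule.span_le.2 ?_
      rintro _ ⟨g, rfl⟩
      refine Submodule.subset_span ⟨QuotientGroup.mk ⟨u, hu⟩ * g, ?_⟩
      simp only [map_mul, Module.End.mul_apply]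
    exact hZ hz
  have hd := hD.isLinearDifferential
  have hmem := h.mem_of_stable hD (S := Z.map (InvSpace ρ).subtype) ⟨w₀, hw₀, rfl⟩
    (fun v hv => hd.apply_mem h.rational (rootVector_sq h01)
      fun t => hstab _ (root_mem_U h01 (by decide) t) v hv)
    (fun v hv => hd.apply_mem h.rational (rootVector_sq h12)
      fun t => hstab _ (root_mem_U h12 (by decide) t) v hv)
  have hle : InvSpace ρ ≤ Z.map (InvSpace ρ).subtype := by
    nth_rw 1 [h.invSpace_eq_span hD]
    refine Submodule.span_le.2 ?_
    rintro _ ⟨x, rfl⟩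
    exact hmem x
  refine eq_top_iff.2 fun z _ => ?_
  obtain ⟨z', hz', hzz⟩ := hle z.2
  rwa [← Subtype.ext (a1 := z') (a2 := z) hzz]

theorem isTEigenvector (h : IsMonomialBasis ρ φ a b w) (x : Fin (a + 1) × Fin (b + 1)) :
    IsTEigenvector ρ (w x) :=
  ⟨h.linearIndependent.ne_zero x, fun _ ht => ⟨_, h.torus_apply ht x⟩⟩

/-- Used with `G = ρ t - 1` for the cyclic vector and with `G = h/2` for the trivial submodule. -/
theorem mem_span_of_eq_zero (h : IsMonomialBasis ρ φ a b w) (hD : IsDifferential ρ D)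
    {v : V} (hv : v ∈ InvSpace ρ) {G : Module.End K V} {ν : Fin (a + 1) × Fin (b + 1) → K}
    (hG : ∀ x, G (w x) = ν x • w x) (hν : ∀ x, x ≠ (0, 0) → ν x ≠ 0) (hGv : G v = 0) :
    ∃ c : K, v = c • w (0, 0) := by
  classical
  rw [h.invSpace_eq_span hD, Submodule.mem_span_range_iff_exists_fun] at hv
  obtain ⟨c, rfl⟩ := hv
  have hc : ∀ x, x ≠ (0, 0) → c x = 0 := by
    have hsum : ∑ x, (c x * ν x) • w x = 0 := by
      rw [← hGv, map_sum]
      simp only [map_smul, hG, smul_smul]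
    intro x hx
    exact (mul_eq_zero.1 (Fintype.linearIndependent_iff.1 h.linearIndependent _ hsum x)
      ).resolve_right (hν x hx)
  exact ⟨c (0, 0), Finset.sum_eq_single_of_mem _ (Finset.mem_univ _) fun x _ hx => by
    rw [hc x hx, zero_smul]⟩

/-- The coefficient `ψ` at `(0, 0)` is constant on `U`-orbits in the invariants, so it is nonzero on
a cyclic vector. This forces a `T`-eigenvector to have the torus weight of `w (0, 0)`. -/
theorem eq_smul_of_isCyclicVector (h : IsMonomialBasis ρ φ a b w) (hD : IsDifferential ρ D)
    {w' : InvSpace ρ} (hcyc : IsCyclicVector (invRep ρ) w') (hT : IsTEigenvector ρ (w' : V)) :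
    ∃ c : K, (w' : V) = c • w (0, 0) := by
  obtain ⟨g, hg⟩ := SlTwoRel.exists_coordinates h.linearIndependent
  have hgw (x y) : g (w x) y = Finsupp.single x (1 : K) y := by
    rw [← hg (Finsupp.single x 1), Finsupp.linearCombination_single, one_smul]
  let ψ : Module.Dual K V := Finsupp.lapply (0, 0) ∘ₗ g
  have hψ : ∀ x, x ≠ (0, 0) → ψ (w x) = 0 := fun x hx =>
    (hgw x (0, 0)).trans (Finsupp.single_eq_of_ne hx.symm)
  have hψ0 : ψ (w (0, 0)) = 1 := (hgw _ _).trans Finsupp.single_eq_same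
  have hne : ψ w' ≠ 0 := by
    intro h0
    have hle : (⊤ : Submodule K (InvSpace ρ)) ≤
        LinearMap.ker (ψ ∘ₗ (InvSpace ρ).subtype) := by
      rw [← hcyc]
      refine Submodule.span_le.2 ?_
      rintro _ ⟨u, rfl⟩
      obtain ⟨u, rfl⟩ := QuotientGroup.mk_surjective u
      exact (h.functional_apply_U hD hψ u.2 w'.2).trans h0
    have := hle (Submodule.mem_top (x := ⟨w (0, 0), h.mem_invSpace hD _⟩))
    exact one_ne_zero (hψ0.symm.trans this)
  -- `diag(2, 1, 1/2)` multiplies the monomial `(i, l)` by `2^(i+l)`, so its eigenvalue is `1` only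
  -- at `(0, 0)`.
  let t : SL3 K := torusElt 2 1 two_ne_zero one_ne_zero
  have ht : t ∈ T K := torusElt_mem _ _ _ _
  have t0 : t 0 0 = 2 := rfl
  have t1 : t 1 1 = 1 := rfl
  have t2 : t⁻¹ 2 2 = 2 := by
    have h1 := torus_inv_mul ht 2
    have h2 := torus_prod ht
    rw [t0, t1] at h2
    linear_combination 2 * h1 - t⁻¹ 2 2 * h2
  have t1' : t⁻¹ 1 1 = 1 := by
    have h1 := torus_inv_mul ht 1
    rwa [t1, mul_one] at h1
  have htw (x : Fin (a + 1) × Fin (b + 1)) :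
      ρ t (w x) = (2 : K) ^ ((x.1 : ℕ) + (x.2 : ℕ)) • w x := by
    rw [h.torus_apply ht, t0, t1, t1', t2, one_pow, one_pow, mul_one, mul_one, pow_add]
  obtain ⟨c, hc⟩ := hT.2 t ht
  have hψt : ψ (ρ t w') = ψ w' := by
    have hv := (h.invSpace_eq_span hD).le w'.2
    have hle : Submodule.span K (Set.range w) ≤ LinearMap.ker (ψ ∘ₗ ρ t - ψ) := by
      refine Submodule.span_le.2 ?_
      rintro _ ⟨x, rfl⟩
      change ψ (ρ t (w x)) - ψ (w x) = 0
      by_cases hx : x = (0, 0)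
      · rw [htw, hx]
        simp
      · rw [htw, map_smul, hψ x hx, smul_zero, sub_zero]
    exact sub_eq_zero.1 (hle hv)
  have hc1 : c = 1 := by
    rw [hc, map_smul, smul_eq_mul] at hψt
    exact (mul_eq_right₀ hne).1 hψt
  refine h.mem_span_of_eq_zero hD w'.2 (G := ρ t - 1)
    (ν := fun x => 2 ^ ((x.1 : ℕ) + (x.2 : ℕ)) - 1) (fun x => ?_) (fun x hx => ?_) ?_
  · rw [LinearMap.sub_apply, htw, sub_smul, one_smul, Module.End.one_apply]
  · have h1 : (x.1 : ℕ) + (x.2 : ℕ) ≠ 0 := fun h0 =>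
      hx (Prod.ext (Fin.ext (by simpa using (Nat.add_eq_zero_iff.1 h0).1))
        (Fin.ext (by simpa using (Nat.add_eq_zero_iff.1 h0).2)))
    have h2 : (2 : ℕ) ^ ((x.1 : ℕ) + (x.2 : ℕ)) ≠ 1 := (Nat.one_lt_two_pow h1).ne'
    refine sub_ne_zero.2 fun h3 => h2 ?_
    exact_mod_cast h3
  · rw [LinearMap.sub_apply, hc, hc1, one_smul, Module.End.one_apply, sub_self]

theorem isASubmodule_and_finrank_eq_one_iff [FiniteDimensional K V]
    (h : IsMonomialBasis ρ φ a b w) (hD : IsDifferential ρ D) (L : Submodule K V) :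
    (IsASubmodule D L ∧ Module.finrank K L = 1) ↔ L = K ∙ w (0, 0) := by
  have hne : w (0, 0) ≠ 0 := h.linearIndependent.ne_zero _
  constructor
  · rintro ⟨hL, h1⟩
    refine Submodule.eq_of_le_of_finrank_eq (fun v hv => ?_)
      (h1.trans (finrank_span_singleton hne).symm)
    obtain ⟨hE, hH⟩ := apply_eq_zero_of_finrank_eq_one hL h1 hv
    obtain ⟨c, rfl⟩ := h.mem_span_of_eq_zero hD
      ((mem_invSpace_iff_apply_eq_zero h.rational hD v).2 hE) (h.halfH_apply hD)
      (fun x hx => Nat.cast_ne_zero.2 fun h0 =>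
        hx (Prod.ext (Fin.ext (by simpa using (Nat.add_eq_zero_iff.1 h0).1))
          (Fin.ext (by simpa using (Nat.add_eq_zero_iff.1 h0).2)))) hH
    exact Submodule.smul_mem _ c (Submodule.mem_span_singleton_self _)
  · rintro rfl
    have hkill {G : Module.End K V} (hG : G (w (0, 0)) = 0) :
        ∀ v ∈ K ∙ w (0, 0), G v ∈ K ∙ w (0, 0) := fun v hv => by
      obtain ⟨c, rfl⟩ := Submodule.mem_span_singleton.1 hv
      rw [map_smul, hG, smul_zero]
      exact zero_mem _
    refine ⟨isASubmodule_iff.2 ⟨hkill (h.eθ_apply hD _), hkill ?_⟩, finrank_span_singleton hne⟩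
    -- For a primitive vector of weight `0` the first vanishing power of `F` is `F` itself.
    exact (slTwoRel D).pow_succ_eq_zero (n := 0) (h.halfH_apply hD (0, 0)) (h.eθ_apply hD _)

/-- The monomials form a basis of `ker e` consisting of `h/2`-eigenvectors, so their strings
decompose `V`; the bijection `e` sorts the strings by `n = i + l`. -/
theorem exists_branching [IsAlgClosed K] [FiniteDimensional K V]
    (h : IsMonomialBasis ρ φ a b w) (hD : IsDifferential ρ D) :
    ∃ S : (Σ n : Fin (a + b + 1), Fin (branchMult (max a b) (min a b) n)) → Submodule K V,
      (∀ i, IsCopyOfR D i.1 (S i)) ∧ DirectSum.IsInternal S := by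
  classical
  obtain ⟨e, he⟩ := exists_branching_equiv a b
  let n (x : Fin (a + 1) × Fin (b + 1)) : ℕ := (x.1 : ℕ) + (x.2 : ℕ)
  have r := slTwoRel D
  have hE := h.eθ_apply hD
  have hH : ∀ x, D (halfH K) (w x) = (n x : K) • w x := h.halfH_apply hD
  have hli := SlTwoRel.linearIndependent_strings r h.linearIndependent hE hH
  have hker (v : V) (hv : D (eθ K) v = 0) : v ∈ Submodule.span K (Set.range w) := by
    rw [← h.invSpace_eq_span hD]
    exact (mem_invSpace_iff_apply_eq_zero h.rational hD v).2 hv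
  refine ⟨fun i => SlTwoRel.stringSpan (D (fθ K)) w n (e i), fun i => ⟨?_, ?_, ?_⟩, ?_⟩
  · exact isASubmodule_iff.2 ⟨fun v hv => SlTwoRel.e_mem_stringSpan r hE hH hv,
      fun v hv => SlTwoRel.f_mem_stringSpan r hE hH hv⟩
  · rw [SlTwoRel.finrank_stringSpan hli, ← he i]
  · intro S hS hSA
    obtain ⟨h1, h2⟩ := isASubmodule_iff.1 hSA
    exact SlTwoRel.eq_bot_or_eq_stringSpan r hli hker hS h1 h2
  · refine DirectSum.isInternal_submodule_of_iSupIndep_of_iSup_eq_top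
      ((SlTwoRel.iSupIndep_stringSpan hli).comp e.injective) ?_
    rw [e.surjective.iSup_comp, SlTwoRel.iSup_stringSpan,
      SlTwoRel.span_strings r hli hE hH hker]

end IsMonomialBasis

end SLThree

theorem theorem4p2 (K : Type*) [Field K] [IsAlgClosed K] [CharZero K] :
    -- the algebra of invariants
    (AlgebraicIndependent K (SLThree.generators K) ∧
      Algebra.adjoin K (Set.range (SLThree.generators K)) = SLThree.invAlgebra K ∧
      ringKrullDim (SLThree.invAlgebra K) = 4) ∧
    -- for every model `V` of `R(a,b)`:
    ∀ (a b : ℕ) (V : Type*) [AddCommGroup V] [Module K V]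
      (ρ : Representation K (SLThree.SL3 K) V), SLThree.IsSimpleOfHighestWeight ρ a b →
      -- the invariants in `R(a,b)`
      Module.finrank K (SLThree.InvSpace ρ) = (a + 1) * (b + 1) ∧
      ∃ w : SLThree.InvSpace ρ,
        SLThree.IsCyclicVector (SLThree.invRep ρ) w ∧ SLThree.IsTEigenvector ρ w ∧
        (∀ w' : SLThree.InvSpace ρ,
          SLThree.IsCyclicVector (SLThree.invRep ρ) w' → SLThree.IsTEigenvector ρ w' →
          ∃ c : K, w' = c • w) ∧
        -- branching to `𝔞`, where `D` is the action of `sl₃` on `V`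
        ∃ D : SLThree.sl3 K →ₗ⁅K⁆ Module.End K V, SLThree.IsDifferential ρ D ∧
          (∃ S : (Σ n : Fin (a + b + 1), Fin (SLThree.branchMult (max a b) (min a b) n)) →
              Submodule K V,
            (∀ i, SLThree.IsCopyOfR D i.1 (S i)) ∧ DirectSum.IsInternal S) ∧
          ∀ L : Submodule K V,
            (SLThree.IsASubmodule D L ∧ Module.finrank K L = 1) ↔ L = K ∙ (w : V) := by
  refine ⟨⟨SLThree.algebraicIndependent_generators, SLThree.adjoin_generators,
    SLThree.ringKrullDim_invAlgebra⟩, fun a b V _ _ ρ hV => ?_⟩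
  have := hV.finite
  obtain ⟨D, hD⟩ := SLThree.exists_isDifferential hV.rational
  obtain ⟨φ, hφ⟩ := hV.exists_isRealization
  obtain ⟨w, h⟩ := hφ.exists_isMonomialBasis hV.rational hD
  refine ⟨h.finrank_invSpace hD, ⟨w (0, 0), h.mem_invSpace hD _⟩, h.isCyclicVector hD,
    h.isTEigenvector _, fun w' hw' hT => ?_, D, hD, h.exists_branching hD,
    h.isASubmodule_and_finrank_eq_one_iff hD⟩
  obtain ⟨c, hc⟩ := h.eq_smul_of_isCyclicVector hD hw' hT
  exact ⟨c, Subtype.ext hc⟩
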